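/- Let $\varphi:\mathbb R\to\mathbb R$ be locally absolutely continuous with $\varphi,\varphi'\in L_2(\mathbb R)$, let $h>0$, $\varphi_h(t)=\varphi(t/h)$, and $$V(\varphi_h)=\Big\{f:\ f(t)=\sum_{k\in\mathbb Z}c_k\varphi_h(t-hk)\ \text{ for all } t\in\mathbb R,\ c\in\ell_2(\mathbb Z)\ \text{real}\Big\}.$$ Assume the Riesz condition: there are $A,B>0$ with $A\|c\|_{\ell_2}\le\|\sum_k c_k\varphi_h(\cdot-hk)\|_{L_2}\le B\|c\|_{\ell_2}$ for all $c\in\ell_2(\mathbb Z)$. For $g\in L_2(\mathbb R)$ put $G_g(\omega)=\big(\sum_{k\in\mathbb Z}|\hat g(\omega+2\pi k/h)|^2\big)^{1/2}$, and let $$S=\operatorname*{ess\,sup}_{|\omega|\le\pi/h}\frac{G_{\varphi_h'}(\omega)}{G_{\varphi_h}(\omega)},\qquad \Delta_{\varphi_h}=\frac{\pi}{S}\quad(=0\text{ if }S=\infty).$$ For $f:\mathbb R\to\mathbb R$ and $\Delta\in\mathbb R$ the critical threshold is $$C_f(\Delta)=\tfrac12\inf_{\tau\in\mathbb R}\Big|\sup_{\tau<t<\tau+\Delta}f(t)-\inf_{\tau<t<\tau+\Delta}f(t)\Big|$$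 (the supremum and infimum over an empty window being $0$). Events of $f$ with threshold $C>0$ are pairs $(t_m,p_m)_{m\in\mathbb Z}$ such that for all $m\in\mathbb Z$ $$t_m=\min\{t>t_{m-1}:|f(t)-f(t_{m-1})|=C\},\qquad p_m=\operatorname{sgn}(f(t_m)-f(t_{m-1})).$$ For instants $t=(t_m)_{m\in\mathbb Z}$ let $\mathfrak D(t)=\sup_m|t_{m+1}-t_m|$, $\gamma=S\,\mathfrak D(t)/\pi$ and $s_m=(t_{m-1}+t_m)/2$; let $\Gamma u=\sum_m u(t_m)\mathbf 1_{[s_m,s_{m+1}]}$, and let $\Pi$ be the orthogonal projection of $L_2(\mathbb R)$ onto $V(\varphi_h)$. From instants $t$ and numbers $(y_m)_{m\in\mathbb Z}$ compute $$f_1=\Pi\Big(\sum_m y_m\mathbf 1_{[s_m,s_{m+1}]}\Big),\qquad f_{k+1}=f_1+(I-\Pi\Gamma)f_k\quad(k\ge1).$$ Say that $f$ is perfectly reconstructed from $(t,y)$ if $f\in L_2(\mathbb R)$, $\gamma<1$, $\|f-f_k\|_{L_2}\le\gamma^k\|f\|_{L_2}$ for all $k\ge1$, and $\|f-f_k\|_{L_2}\to0$.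 Then: (i) Let $f\in V(\varphi_h)$ with $C_f(\Delta_{\varphi_h})>0$, and let $(t_m,p_m)_{m\in\mathbb Z}$ be events of $f$ with threshold $0<C<C_f(\Delta_{\varphi_h})$. Then $(t_m)$ is strictly increasing, $t_m\to\pm\infty$ as $m\to\pm\infty$, $\mathfrak D(t)<\Delta_{\varphi_h}$, and $f$ is perfectly reconstructed from its events: $f(t_m)=y_m$ for all $m\in\mathbb Z$, where $y_m=f(t_0)+C\sum_{i=1}^m p_i$ for $m\ge0$ and $y_m=f(t_0)-C\sum_{i=m+1}^{0}p_i$ for $m<0$, and $f$ is perfectly reconstructed from $(t,y)$. (ii) The density of the events does not depend on $f\in V(\varphi_h)$: if $f:\mathbb R\to\mathbb R$ is any uniformly continuous function, $\Delta\in\mathbb R$, and $(t_m,p_m)_{m\in\mathbb Z}$ are events of $f$ with threshold $0<C<C_f(\Delta)$, then $(t_m)$ is strictly increasing, $t_m\to\pm\infty$ as $m\to\pm\infty$, $\mathfrak D(t)<\Delta$, and $f(t_m)=y_m$ for all $m$, with $y_m$ as in (i). (iii) If $(t_m)_{m\in\mathbb Z}$ is any strictly increasing sequence with $t_m\to\pm\infty$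 as $m\to\pm\infty$ and $\mathfrak D(t)<\Delta_{\varphi_h}$, then every $f\in V(\varphi_h)$ is perfectly reconstructed from $(t,(f(t_m))_m)$. -/

import Mathlib

open MeasureTheory Filter Topology Set
open scoped ENNReal FourierTransform

noncomputable section

/-- The `h`-scaled kernel `φ_h(t) = φ(t / h)`. -/
def scaledKernel (φ : ℝ → ℝ) (h : ℝ) : ℝ → ℝ := fun t => φ (t / h)

/-- `f(t) = ∑_{k ∈ ℤ} c_k g(t - h k)` at every `t`. -/
def IsSynthesis (g : ℝ → ℝ) (h : ℝ) (c : lp (fun _ : ℤ => ℝ) 2) (f : ℝ → ℝ) : Prop :=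
  ∀ t : ℝ, HasSum (fun k : ℤ => c k * g (t - h * k)) (f t)

/-- The `h`-shift-invariant space `V(g)` of all `∑ c_k g(· - h k)` with `c ∈ ℓ²(ℤ)`. -/
def shiftInvariantSpace (g : ℝ → ℝ) (h : ℝ) : Set (ℝ → ℝ) :=
  {f | ∃ c : lp (fun _ : ℤ => ℝ) 2, IsSynthesis g h c f}

/-- The Riesz condition `A ‖c‖ ≤ ‖∑ c_k g(· - h k)‖_{L²} ≤ B ‖c‖` with `0 < A`, `0 < B`. -/
def IsRieszGenerator (g : ℝ → ℝ) (h : ℝ) : Prop :=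
  ∃ A B : ℝ, 0 < A ∧ 0 < B ∧
    ∀ (c : lp (fun _ : ℤ => ℝ) 2) (f : ℝ → ℝ), IsSynthesis g h c f →
      ENNReal.ofReal (A * ‖c‖) ≤ eLpNorm f 2 volume ∧
      eLpNorm f 2 volume ≤ ENNReal.ofReal (B * ‖c‖)

open Classical in
/-- The `L²` Fourier transform in angular frequency,
`ĝ(ω) = ∫ g(t) e^{-i ω t} dt` for integrable `g` (an almost everywhere defined function). -/
def angularFourier (g : ℝ → ℝ) : ℝ → ℂ :=
  if hg : MemLp (fun t => (g t : ℂ)) 2 (volume : Measure ℝ) then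
    fun ω => (𝓕 (hg.toLp (fun t => (g t : ℂ))) : Lp ℂ 2 (volume : Measure ℝ)) (ω / (2 * Real.pi))
  else 0

/-- `G_g(ω) = (∑_{k ∈ ℤ} |ĝ(ω + 2πk/h)|²)^{1/2}`. -/
def autocorrelationSpectrum (h : ℝ) (g : ℝ → ℝ) (ω : ℝ) : ℝ≥0∞ :=
  (∑' k : ℤ, ‖angularFourier g (ω + 2 * Real.pi * k / h)‖ₑ ^ 2) ^ (1 / 2 : ℝ)

/-- `sup_{ω ∈ [-π/h, π/h]} G_{D g}(ω) / G_g(ω)`. Spectra of `L²` functions are defined up to null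
sets, so the supremum is the essential one. -/
def spectralRatio (h : ℝ) (g : ℝ → ℝ) : ℝ≥0∞ :=
  essSup (fun ω => autocorrelationSpectrum h (deriv g) ω / autocorrelationSpectrum h g ω)
    (volume.restrict (Icc (-(Real.pi / h)) (Real.pi / h)))

/-- `Δ_g = π (sup_ω G_{D g}(ω) / G_g(ω))⁻¹`; it is `0` if the supremum is infinite. -/
def maxSpacing (h : ℝ) (g : ℝ → ℝ) : ℝ :=
  (ENNReal.ofReal Real.pi / spectralRatio h g).toReal

/-- The critical threshold `C_f(Δ)`: half of the infimum over `τ` of the oscillation of `f` on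
the window `(τ, τ + Δ)`. -/
def criticalThreshold (f : ℝ → ℝ) (Δ : ℝ) : ℝ :=
  (1 / 2) * ⨅ τ : ℝ, |sSup (f '' Ioo τ (τ + Δ)) - sInf (f '' Ioo τ (τ + Δ))|

/-- `(t_m, p_m)_{m ∈ ℤ}` is the output of the neuromorphic encoder with threshold `C` at the
input `f`: `t_m` is the first time after `t_{m-1}` at which `f` differs from `f(t_{m-1})` by
exactly `C`, and `p_m` is the sign of the change. -/
def IsEventStream (f : ℝ → ℝ) (C : ℝ) (t p : ℤ → ℝ) : Prop :=
  ∀ m : ℤ, IsLeast {s : ℝ | t (m - 1) < s ∧ |f s - f (t (m - 1))| = C} (t m) ∧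
    p m = Real.sign (f (t m) - f (t (m - 1)))

/-- The sampling density `sup_m |t_{m+1} - t_m|`, with value in `[0, ∞]`. -/
def samplingDensity (t : ℤ → ℝ) : ℝ≥0∞ :=
  ⨆ m : ℤ, ENNReal.ofReal |t (m + 1) - t m|

/-- The amplitudes that are computed from the polarities, the threshold and the initial value
`a = f(t_0)`: `a + C ∑_{i=1}^m p_i` for `m ≥ 0`, and `a - C ∑_{i=m+1}^0 p_i` for `m < 0`. -/
def eventSamples (C a : ℝ) (p : ℤ → ℝ) (m : ℤ) : ℝ :=
  a + C * (∑ i ∈ Finset.Ioc 0 m, p i - ∑ i ∈ Finset.Ioc m 0, p i)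

/-- The piecewise-constant interpolation `∑_m y_m 1_{[s_m, s_{m+1}]}` of the samples `y_m` at
the instants `t_m`, where `s_m = (t_{m-1} + t_m) / 2`. -/
def piecewiseConstant (t y : ℤ → ℝ) (x : ℝ) : ℝ :=
  ∑' m : ℤ, (Icc ((t (m - 1) + t m) / 2) ((t m + t (m + 1)) / 2)).indicator (fun _ => y m) x

/-- `v` is the orthogonal projection of `u` onto `V(g)` in `L²(ℝ)`. -/
def IsOrthProj (g : ℝ → ℝ) (h : ℝ) (u v : ℝ → ℝ) : Prop :=
  v ∈ shiftInvariantSpace g h ∧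
    ∀ w ∈ shiftInvariantSpace g h, ∫ x, (u x - v x) * w x = 0

open Classical in
/-- The orthogonal projection `Π_g u` of `u` onto `V(g)`. -/
def orthProj (g : ℝ → ℝ) (h : ℝ) (u : ℝ → ℝ) : ℝ → ℝ :=
  if hu : ∃ v, IsOrthProj g h u v then hu.choose else 0

/-- The iterates computed from the instants `t` and the samples `y`. The value at `k` is the
iterate `f_{k+1}`: one has `f_1 = Π_g (∑_m y_m 1_{[s_m, s_{m+1}]})` and
`f_{k+1} = f_1 + (I - Π_g Γ) f_k`, with `Γ f = ∑_m f(t_m) 1_{[s_m, s_{m+1}]}`. -/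
def reconIterate (g : ℝ → ℝ) (h : ℝ) (t y : ℤ → ℝ) : ℕ → ℝ → ℝ
  | 0 => orthProj g h (piecewiseConstant t y)
  | k + 1 =>
    orthProj g h (piecewiseConstant t y) +
      (reconIterate g h t y k -
        orthProj g h (piecewiseConstant t (fun m => reconIterate g h t y k (t m))))

/-- The contraction factor `γ = (sup_ω G_{D g}(ω) / G_g(ω)) · sup_m |t_{m+1} - t_m| / π`. -/
def contractionFactor (h : ℝ) (g : ℝ → ℝ) (t : ℤ → ℝ) : ℝ≥0∞ :=
  spectralRatio h g * samplingDensity t / ENNReal.ofReal Real.pi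

/-- The iterates computed from the instants `t` and the samples `y` recover `f` in `L²(ℝ)` with
geometric rate: `‖f - f_k‖ ≤ γ^k ‖f‖` for all `k ≥ 1`, where `γ < 1`, and `f_k → f`. -/
def IsReconstructedFrom (f : ℝ → ℝ) (g : ℝ → ℝ) (h : ℝ) (t y : ℤ → ℝ) : Prop :=
  MemLp f 2 volume ∧ contractionFactor h g t < 1 ∧
    (∀ k : ℕ, eLpNorm (f - reconIterate g h t y k) 2 volume
      ≤ contractionFactor h g t ^ (k + 1) * eLpNorm f 2 volume) ∧
    Tendsto (fun k : ℕ => eLpNorm (f - reconIterate g h t y k) 2 volume) atTop (𝓝 0)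

end

/-!
Write `g = φ_h`, `V = V(g)`, and let `S` be the spectral ratio of `g`.

*Reconstruction.* Two sharp inequalities show that the piecewise-constant interpolation
`Γ f = ∑ f(t_m) 1_{[s_m, s_{m+1}]}` of any `f ∈ V` satisfies `‖f - Γ f‖ ≤ γ ‖f‖`.

* Wirtinger: on each side of `t_m` the cell `[s_m, s_{m+1}]` has length at most `𝔇 / 2`, and
  `f - f(t_m)` vanishes at `t_m`; summing over the cells gives `‖f - Γ f‖ ≤ (𝔇 / π) ‖f'‖`
  (`HasL2Deriv.eLpNorm_sub_piecewiseConstant_le`).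
* Bernstein: translation becomes modulation under the Fourier transform, so that
  `2π ‖∑ c_k g(· - h k)‖²` is the integral of `|∑ c_k e^{-i h k ω}|² G_g(ω)²` over one period.
  The same identity for `g'` and the definition of `S` yield `‖f'‖ ≤ S ‖f‖`
  (`eLpNorm_finSynthesis_deriv_le`).

Both are needed for finite sums of shifts only. The bound on `f - Γ f` passes to all of `V`
(`eLpNorm_sub_piecewiseConstant_le`): truncations of the coefficients converge in `L²` by the upper
Riesz bound, and pointwise because the samples `(g(t - h k))_k` form an `ℓ²` sequence for each `t`
(here `φ, φ' ∈ L²` enters), so Fatou's lemma applies.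

The Riesz bounds make `V` closed in `L²(ℝ)`, so the projection `Π` exists. The errors
`e_k = f - f_k` stay in `V` and `e_{k+1} = Π (e_k - Γ e_k)`; hence each step contracts by `γ`, and
`γ < 1` is the assumption `𝔇 < π / S` (`isReconstructedFrom_samples`).

*Events.* Between two events `f` stays within `C` of its value at the first one, so it oscillates by
at most `2 C < 2 C_f(Δ)` there and the gap is smaller than `Δ`. Uniform continuity keeps the gaps
uniformly away from `Δ` (`IsEventStream.exists_gap_le`). Every `f ∈ V` is uniformly continuous, as
the `ℓ²` sequence of samples depends uniformly continuously on `t`; therefore the events of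
`f ∈ V` satisfy the density condition under which reconstruction works.
-/

noncomputable section

/-! ### Events below the critical threshold -/

namespace IsEventStream

variable {f : ℝ → ℝ} {C : ℝ} {t p : ℤ → ℝ}

lemma strictMono (hs : IsEventStream f C t p) : StrictMono t := by
  refine strictMono_int_of_lt_succ fun m => ?_
  simpa using (hs (m + 1)).1.1.1

lemma abs_sub_eq (hs : IsEventStream f C t p) (m : ℤ) : |f (t m) - f (t (m - 1))| = C :=
  (hs m).1.1.2

lemma sub_eq_mul_polarity (hs : IsEventStream f C t p) (m : ℤ) :
    f (t m) - f (t (m - 1)) = C * p m := by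
  rw [(hs m).2, ← hs.abs_sub_eq m]
  rcases lt_trichotomy (f (t m) - f (t (m - 1))) 0 with h | h | h
  · rw [Real.sign_of_neg h, abs_of_neg h]; ring
  · rw [h]; simp
  · rw [Real.sign_of_pos h, abs_of_pos h]; ring

/-- Events do not accumulate: along a convergent sequence of instants the increments of `f`
would tend to zero, but they all have size `C`. -/
lemma not_tendsto_nhds (hs : IsEventStream f C t p) (hf : Continuous f) (hC : 0 < C)
    {l : Filter ℤ} [l.NeBot] (hl : Tendsto (fun m : ℤ => m - 1) l l) (a : ℝ) :
    ¬ Tendsto t l (𝓝 a) := by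
  intro ha
  have h1 : Tendsto (fun m => f (t m)) l (𝓝 (f a)) := (hf.tendsto a).comp ha
  have h2 := (h1.sub (h1.comp hl)).abs
  have h3 : (fun m : ℤ => |f (t m) - ((fun m => f (t m)) ∘ fun m : ℤ => m - 1) m|) = fun _ => C :=
    funext fun m => hs.abs_sub_eq m
  rw [h3, sub_self, abs_zero] at h2
  exact hC.ne' (tendsto_nhds_unique tendsto_const_nhds h2)

lemma tendsto_atTop (hs : IsEventStream f C t p) (hf : Continuous f) (hC : 0 < C) :
    Tendsto t atTop atTop := by
  rcases tendsto_atTop_of_monotone hs.strictMono.monotone with h | ⟨a, h⟩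
  · exact h
  · exact absurd h (hs.not_tendsto_nhds hf hC (tendsto_atTop_add_const_right _ _ tendsto_id) a)

lemma tendsto_atBot (hs : IsEventStream f C t p) (hf : Continuous f) (hC : 0 < C) :
    Tendsto t atBot atBot := by
  by_cases hb : BddBelow (range t)
  · exact absurd (tendsto_atBot_ciInf hs.strictMono.monotone hb)
      (hs.not_tendsto_nhds hf hC (tendsto_atBot_add_const_right _ _ tendsto_id) _)
  · refine tendsto_atBot_atBot_of_monotone hs.strictMono.monotone fun b => ?_
    by_contra! hcon
    exact hb ⟨b, by rintro _ ⟨m, rfl⟩; exact (hcon m).le⟩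

/-- Between consecutive events the signal stays within `C` of its value at the last event. -/
lemma abs_sub_le_threshold (hs : IsEventStream f C t p) (hf : Continuous f) (hC : 0 < C)
    (m : ℤ) {s : ℝ} (h1 : t m ≤ s) (h2 : s ≤ t (m + 1)) : |f s - f (t m)| ≤ C := by
  by_contra! hlt
  have hcont : ContinuousOn (fun r => |f r - f (t m)|) (Icc (t m) s) := by fun_prop
  obtain ⟨r, hr, hrC⟩ := intermediate_value_Icc h1 hcont
    (show C ∈ Icc (|f (t m) - f (t m)|) (|f s - f (t m)|) by simpa using ⟨hC.le, hlt.le⟩)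
  have hrm : t m < r := lt_of_le_of_ne hr.1 (by rintro rfl; simp at hrC; exact hC.ne hrC)
  have hrs : r < s := lt_of_le_of_ne hr.2 (by rintro rfl; exact hlt.ne' hrC)
  have := (hs (m + 1)).1.2 (show r ∈ _ by simpa using ⟨hrm, hrC⟩)
  linarith

/-- The gaps between events stay uniformly below `Δ`. Uniform continuity lets the window
`(t_m, t_{m+1})`, on which `f` oscillates by at most `2 C`, be prolonged by a `δ` that does not
depend on `m` while the oscillation remains below `2 C_f(Δ)`. -/
lemma exists_gap_le (hs : IsEventStream f C t p) (hf : UniformContinuous f) (hC : 0 < C) {Δ : ℝ}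
    (hΔ : C < criticalThreshold f Δ) : ∃ δ > 0, ∀ m : ℤ, t (m + 1) - t m ≤ Δ - δ := by
  set κ := criticalThreshold f Δ with hκ
  obtain ⟨δ, hδ, hδf⟩ := Metric.uniformContinuous_iff.1 hf ((κ - C) / 2) (by linarith)
  refine ⟨δ, hδ, fun m => ?_⟩
  by_contra! hlt
  have hbd : ∀ s ∈ Ioo (t m) (t m + Δ), |f s - f (t m)| ≤ (C + κ) / 2 := by
    intro s hsm
    rcases le_total s (t (m + 1)) with h | h
    · have := hs.abs_sub_le_threshold hf.continuous hC m hsm.1.le h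
      linarith
    · have h1 := hs.abs_sub_le_threshold hf.continuous hC m (hs.strictMono (lt_add_one m)).le le_rfl
      have h2 : dist s (t (m + 1)) < δ := by
        rw [Real.dist_eq, abs_of_nonneg (by linarith)]
        linarith [hsm.2]
      have h3 := hδf h2
      rw [Real.dist_eq] at h3
      have := abs_sub_le (f s) (f (t (m + 1))) (f (t m))
      linarith
  have hosc : |sSup (f '' Ioo (t m) (t m + Δ)) - sInf (f '' Ioo (t m) (t m + Δ))| ≤ C + κ := by
    rcases (Ioo (t m) (t m + Δ)).eq_empty_or_nonempty with he | hne
    · rw [he]; simp; linarith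
    · have hne' := hne.image f
      have hU : ∀ y ∈ f '' Ioo (t m) (t m + Δ), y ≤ f (t m) + (C + κ) / 2 := by
        rintro _ ⟨s, hsm, rfl⟩
        linarith [(abs_le.1 (hbd s hsm)).2]
      have hL : ∀ y ∈ f '' Ioo (t m) (t m + Δ), f (t m) - (C + κ) / 2 ≤ y := by
        rintro _ ⟨s, hsm, rfl⟩
        linarith [(abs_le.1 (hbd s hsm)).1]
      have h1 := csSup_le hne' hU
      have h2 := le_csInf hne' hL
      have h3 := csInf_le_csSup hne' ⟨_, fun y hy => hL y hy⟩ ⟨_, fun y hy => hU y hy⟩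
      rw [abs_of_nonneg (by linarith)]
      linarith
  have hinf : 2 * κ ≤ |sSup (f '' Ioo (t m) (t m + Δ)) - sInf (f '' Ioo (t m) (t m + Δ))| := by
    have := ciInf_le (f := fun τ : ℝ => |sSup (f '' Ioo τ (τ + Δ)) - sInf (f '' Ioo τ (τ + Δ))|)
      ⟨0, by rintro _ ⟨τ, rfl⟩; exact abs_nonneg _⟩ (t m)
    rw [hκ, criticalThreshold]
    linarith
  linarith

lemma samplingDensity_lt (hs : IsEventStream f C t p) (hf : UniformContinuous f) (hC : 0 < C)
    {Δ : ℝ} (hΔ : C < criticalThreshold f Δ) : samplingDensity t < ENNReal.ofReal Δ := by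
  obtain ⟨δ, hδ, hgap⟩ := hs.exists_gap_le hf hC hΔ
  have hmono := hs.strictMono
  refine lt_of_le_of_lt (iSup_le fun m => ENNReal.ofReal_le_ofReal ?_)
    (ENNReal.ofReal_lt_ofReal_iff' (p := Δ - δ).2 ⟨by linarith, ?_⟩)
  · rw [abs_of_pos (sub_pos.2 (hmono (lt_add_one m)))]
    exact hgap m
  · linarith [hgap 0, hmono (lt_add_one (0 : ℤ))]

end IsEventStream

lemma eventSamples_sub_eventSamples (C a : ℝ) (p : ℤ → ℝ) (m : ℤ) :
    eventSamples C a p m - eventSamples C a p (m - 1) = C * p m := by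
  unfold eventSamples
  rcases le_or_gt 1 m with hm | hm
  · have h1 : Finset.Ioc 0 m = insert m (Finset.Ioc 0 (m - 1)) := by ext i; simp; omega
    have h2 : Finset.Ioc m 0 = ∅ := by ext i; simp; omega
    have h3 : Finset.Ioc (m - 1) 0 = ∅ := by ext i; simp; omega
    rw [h1, h2, h3, Finset.sum_insert (by simp)]
    simp; ring
  · have h1 : Finset.Ioc (m - 1) 0 = insert m (Finset.Ioc m 0) := by ext i; simp; omega
    have h2 : Finset.Ioc 0 m = ∅ := by ext i; simp; omega
    have h3 : Finset.Ioc 0 (m - 1) = ∅ := by ext i; simp; omega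
    rw [h1, h2, h3, Finset.sum_insert (by simp)]
    simp; ring

lemma IsEventStream.apply_eq_eventSamples {f : ℝ → ℝ} {C : ℝ} {t p : ℤ → ℝ}
    (hs : IsEventStream f C t p) (m : ℤ) : f (t m) = eventSamples C (f (t 0)) p m := by
  have key : ∀ m : ℤ, f (t m) - eventSamples C (f (t 0)) p m
      = f (t (m - 1)) - eventSamples C (f (t 0)) p (m - 1) := fun m => by
    linarith [hs.sub_eq_mul_polarity m, eventSamples_sub_eventSamples C (f (t 0)) p m]
  suffices f (t m) - eventSamples C (f (t 0)) p m = 0 by linarith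
  induction m using Int.induction_on with
  | zero => simp [eventSamples]
  | succ i ih => rw [key]; simpa using ih
  | pred i ih => rw [← key]; exact ih

/-! ### Functions with square-integrable derivative and Wirtinger's inequality -/

/-- `f` is locally absolutely continuous with derivative `v ∈ L²(ℝ)`, expressed by the fundamental
theorem of calculus. -/
structure HasL2Deriv (f v : ℝ → ℝ) : Prop where
  memLp : MemLp v 2 volume
  integral_eq : ∀ a b : ℝ, ∫ x in a..b, v x = f b - f a

lemma MeasureTheory.MemLp.intervalIntegrable_two {v : ℝ → ℝ} (hv : MemLp v 2 volume) (a b : ℝ) :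
    IntervalIntegrable v volume a b :=
  intervalIntegrable_iff.2 <| ((hv.locallyIntegrable one_le_two).integrableOn_isCompact
    isCompact_uIcc).mono_set uIoc_subset_uIcc

lemma MeasureTheory.MemLp.intervalIntegrable_sq {v : ℝ → ℝ} (hv : MemLp v 2 volume) (a b : ℝ) :
    IntervalIntegrable (fun x => v x ^ 2) volume a b :=
  hv.integrable_sq.intervalIntegrable

namespace HasL2Deriv

variable {f v : ℝ → ℝ}

lemma eq_integral (hf : HasL2Deriv f v) (a : ℝ) : f = fun x => f a + ∫ y in a..x, v y := by
  ext x; rw [hf.integral_eq]; ring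

lemma absolutelyContinuous (hf : HasL2Deriv f v) (a b : ℝ) :
    AbsolutelyContinuousOnInterval f a b := by
  have h1 := (hf.memLp.intervalIntegrable_two a b).absolutelyContinuousOnInterval_intervalIntegral
    (c := a) (by simp)
  have h2 : AbsolutelyContinuousOnInterval (fun _ : ℝ => f a) a b :=
    contDiffOn_const.absolutelyContinuousOnInterval
  rw [hf.eq_integral a]
  exact h2.add h1

lemma continuous (hf : HasL2Deriv f v) : Continuous f := by
  rw [hf.eq_integral 0]
  exact continuous_const.add (intervalIntegral.continuous_primitive
    (fun a b => hf.memLp.intervalIntegrable_two a b) 0)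

lemma ae_hasDerivAt (hf : HasL2Deriv f v) : ∀ᵐ x, HasDerivAt f (v x) x := by
  filter_upwards [LocallyIntegrable.ae_hasDerivAt_integral
    (hf.memLp.locallyIntegrable one_le_two)] with x hx
  rw [hf.eq_integral 0]
  exact (hx 0).const_add _

lemma sub_const (hf : HasL2Deriv f v) (a : ℝ) : HasL2Deriv (fun x => f x - a) v :=
  ⟨hf.memLp, fun b c => by rw [hf.integral_eq]; ring⟩

lemma comp_neg (hf : HasL2Deriv f v) : HasL2Deriv (fun x => f (-x)) (fun x => -v (-x)) := by
  refine ⟨(hf.memLp.comp_measurePreserving (Measure.measurePreserving_neg volume)).neg,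
    fun a b => ?_⟩
  rw [intervalIntegral.integral_neg, intervalIntegral.integral_comp_neg, hf.integral_eq]
  ring

lemma const_mul (hf : HasL2Deriv f v) (a : ℝ) :
    HasL2Deriv (fun x => a * f x) (fun x => a * v x) :=
  ⟨hf.memLp.const_mul a, fun b c => by
    rw [intervalIntegral.integral_const_mul, hf.integral_eq]; ring⟩

lemma comp_sub_right (hf : HasL2Deriv f v) (a : ℝ) :
    HasL2Deriv (fun x => f (x - a)) (fun x => v (x - a)) :=
  ⟨hf.memLp.comp_measurePreserving (measurePreserving_sub_right volume a), fun b c => by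
    rw [intervalIntegral.integral_comp_sub_right, hf.integral_eq]⟩

lemma finset_sum {ι : Type*} {F V : ι → ℝ → ℝ} (s : Finset ι) (hF : ∀ i, HasL2Deriv (F i) (V i)) :
    HasL2Deriv (fun x => ∑ i ∈ s, F i x) (fun x => ∑ i ∈ s, V i x) := by
  refine ⟨memLp_finsetSum s fun i _ => (hF i).memLp, fun a b => ?_⟩
  rw [intervalIntegral.integral_finsetSum fun i _ => (hF i).memLp.intervalIntegrable_two a b,
    ← Finset.sum_sub_distrib]
  exact Finset.sum_congr rfl fun i _ => (hF i).integral_eq a b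

/-- Increments of a function with square-integrable derivative (Cauchy-Schwarz, obtained by
expanding `∫ (v - m)² ≥ 0` for the mean slope `m`). -/
lemma sq_sub_le (hf : HasL2Deriv f v) {a b : ℝ} (hab : a ≤ b) :
    (f b - f a) ^ 2 ≤ (b - a) * ∫ x in a..b, v x ^ 2 := by
  rcases hab.eq_or_lt with rfl | hlt
  · simp
  have hpos : 0 < b - a := sub_pos.2 hlt
  set m := (f b - f a) / (b - a) with hm
  have hv1 := hf.memLp.intervalIntegrable_two a b
  have hv2 := hf.memLp.intervalIntegrable_sq a b
  have h0 : 0 ≤ ∫ x in a..b, (v x - m) ^ 2 :=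
    intervalIntegral.integral_nonneg hab fun x _ => sq_nonneg _
  have h1 : ∫ x in a..b, (v x - m) ^ 2
      = (∫ x in a..b, v x ^ 2) - 2 * m * (f b - f a) + m ^ 2 * (b - a) := by
    have : ∀ x, (v x - m) ^ 2 = v x ^ 2 - 2 * m * v x + m ^ 2 := fun x => by ring
    simp_rw [this]
    rw [intervalIntegral.integral_add (hv2.sub (hv1.const_mul _)) (by simp),
      intervalIntegral.integral_sub hv2 (hv1.const_mul _), intervalIntegral.integral_const_mul,
      hf.integral_eq]
    simp [mul_comm]
  have h2 : m * (b - a) = f b - f a := div_mul_cancel₀ _ hpos.ne'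
  rw [h1] at h0
  have h3 : 0 ≤ (b - a) * ((∫ x in a..b, v x ^ 2) - 2 * m * (f b - f a) + m ^ 2 * (b - a)) :=
    mul_nonneg hpos.le h0
  rw [← h2] at h3 ⊢
  nlinarith

end HasL2Deriv

/-- Wirtinger's inequality with a constant `k` below the sharp one. The function
`q(x) = k tan (k (b - x))` solves the Riccati equation `q' = - k² - q²` and vanishes at `b`, so
`v² - k² f² = (v - q f)² + (q f²)'`, and `q f²` vanishes at both ends. -/
lemma HasL2Deriv.sq_mul_integral_sq_le {f v : ℝ → ℝ} (hf : HasL2Deriv f v) {a b k : ℝ}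
    (hab : a ≤ b) (hfa : f a = 0) (hk : 0 < k) (hkb : k * (b - a) < Real.pi / 2) :
    k ^ 2 * ∫ x in a..b, f x ^ 2 ≤ ∫ x in a..b, v x ^ 2 := by
  set q : ℝ → ℝ := fun x => k * Real.tan (k * (b - x)) with hq
  have hcos : ∀ x ∈ uIcc a b, 0 < Real.cos (k * (b - x)) := by
    intro x hx
    rw [uIcc_of_le hab] at hx
    refine Real.cos_pos_of_mem_Ioo ⟨?_, ?_⟩
    · have := mul_nonneg hk.le (sub_nonneg.2 hx.2)
      linarith [Real.pi_pos]
    · have := mul_le_mul_of_nonneg_left (show b - x ≤ b - a by linarith [hx.1]) hk.le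
      linarith
  have hqd : ∀ x ∈ uIcc a b, HasDerivAt q (-k ^ 2 - q x ^ 2) x := by
    intro x hx
    have hc := (hcos x hx).ne'
    have h1 : HasDerivAt (fun x : ℝ => k * (b - x)) (k * (-1)) x :=
      ((hasDerivAt_id x).const_sub b).const_mul k
    have h2 := (((Real.hasDerivAt_tan hc).comp x h1).const_mul k)
    refine h2.congr_deriv ?_
    simp only [hq]
    rw [Real.tan_eq_sin_div_cos]
    field_simp
    linear_combination Real.sin_sq_add_cos_sq (k * (b - x))
  have hqc : ContDiffOn ℝ 1 q (uIcc a b) := by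
    intro x hx
    refine ContDiffAt.contDiffWithinAt (contDiffAt_const.mul ?_)
    exact ContDiffAt.comp (g := Real.tan) (f := fun y => k * (b - y)) x
      (Real.contDiffAt_tan.2 (hcos x hx).ne') (by fun_prop)
  have hfac := hf.absolutelyContinuous a b
  have hW := hqc.absolutelyContinuousOnInterval.fun_mul (hfac.fun_mul hfac)
  have hWint := hW.integral_deriv_eq_sub
  have hWd : ∀ᵐ x, x ∈ uIcc a b → deriv (fun x => q x * (f x * f x)) x
      = v x ^ 2 - k ^ 2 * f x ^ 2 - (v x - q x * f x) ^ 2 := by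
    filter_upwards [hf.ae_hasDerivAt] with x hx hxab
    rw [((hqd x hxab).fun_mul (hx.fun_mul hx)).deriv]
    ring
  have hfi : IntervalIntegrable (fun x => f x ^ 2) volume a b :=
    (hf.continuous.pow 2).intervalIntegrable a b
  have hvi := hf.memLp.intervalIntegrable_sq a b
  have hWi := hW.intervalIntegrable_deriv
  have h0 : 0 ≤ ∫ x in a..b, (v x ^ 2 - k ^ 2 * f x ^ 2)
      - deriv (fun x => q x * (f x * f x)) x := by
    refine intervalIntegral.integral_nonneg_of_ae_restrict hab ?_
    rw [Filter.EventuallyLE, ae_restrict_iff' measurableSet_Icc]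
    filter_upwards [hWd] with x hx hxab
    rw [hx (by rwa [uIcc_of_le hab])]
    simp only [Pi.zero_apply]
    nlinarith [sq_nonneg (v x - q x * f x)]
  rw [intervalIntegral.integral_sub (hvi.sub (hfi.const_mul _)) hWi,
    intervalIntegral.integral_sub hvi (hfi.const_mul _), intervalIntegral.integral_const_mul,
    hWint] at h0
  have hqb : q b = 0 := by simp [hq]
  rw [hqb, hfa] at h0
  linarith

/-- Wirtinger's inequality on an interval at whose left end the function vanishes. -/
lemma HasL2Deriv.integral_sq_le_of_left {f v : ℝ → ℝ} (hf : HasL2Deriv f v) {a b d : ℝ}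
    (hab : a ≤ b) (hfa : f a = 0) (hd : 0 < d) (hbd : b - a ≤ d / 2) :
    ∫ x in a..b, f x ^ 2 ≤ (d / Real.pi) ^ 2 * ∫ x in a..b, v x ^ 2 := by
  have hpi := Real.pi_pos
  have hK : 0 < Real.pi / d := by positivity
  have h1 : (Real.pi / d) ^ 2 * ∫ x in a..b, f x ^ 2 ≤ ∫ x in a..b, v x ^ 2 := by
    have hlim : Tendsto (fun k : ℝ => k ^ 2 * ∫ x in a..b, f x ^ 2) (𝓝[<] (Real.pi / d))
        (𝓝 ((Real.pi / d) ^ 2 * ∫ x in a..b, f x ^ 2)) :=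
      ((continuous_pow 2).mul continuous_const).continuousAt.mono_left nhdsWithin_le_nhds
    refine le_of_tendsto hlim ?_
    filter_upwards [Ioo_mem_nhdsLT hK] with k hk
    refine hf.sq_mul_integral_sq_le hab hfa hk.1 ?_
    calc k * (b - a) ≤ k * (d / 2) := mul_le_mul_of_nonneg_left hbd hk.1.le
      _ < Real.pi / d * (d / 2) := mul_lt_mul_of_pos_right hk.2 (by linarith)
      _ = Real.pi / 2 := by field_simp
  calc ∫ x in a..b, f x ^ 2
      = (d / Real.pi) ^ 2 * ((Real.pi / d) ^ 2 * ∫ x in a..b, f x ^ 2) := by field_simp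
    _ ≤ _ := mul_le_mul_of_nonneg_left h1 (by positivity)

/-- Wirtinger's inequality for the deviation of `f` from its value at an interior point `τ`:
it is the one-sided inequality on both sides of `τ`. -/
lemma HasL2Deriv.integral_sq_sub_le {f v : ℝ → ℝ} (hf : HasL2Deriv f v) {a b τ d : ℝ}
    (haτ : a ≤ τ) (hτb : τ ≤ b) (hd : 0 < d) (h1 : τ - a ≤ d / 2) (h2 : b - τ ≤ d / 2) :
    ∫ x in a..b, (f x - f τ) ^ 2 ≤ (d / Real.pi) ^ 2 * ∫ x in a..b, v x ^ 2 := by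
  have hg := hf.sub_const (f τ)
  have hr := hg.integral_sq_le_of_left hτb (sub_self _) hd h2
  have hl := hg.comp_neg.integral_sq_le_of_left (a := -τ) (b := -a) (neg_le_neg haτ) (by simp) hd
    (by linarith)
  rw [intervalIntegral.integral_comp_neg (fun x => (f x - f τ) ^ 2)] at hl
  simp_rw [neg_sq] at hl
  rw [intervalIntegral.integral_comp_neg (fun x => v x ^ 2)] at hl
  simp only [neg_neg] at hl
  have hc : ∀ x y : ℝ, IntervalIntegrable (fun x => (f x - f τ) ^ 2) volume x y := fun x y =>
    (hg.continuous.pow 2).intervalIntegrable x y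
  rw [← intervalIntegral.integral_add_adjacent_intervals (hc a τ) (hc τ b),
    ← intervalIntegral.integral_add_adjacent_intervals (hf.memLp.intervalIntegrable_sq a τ)
      (hf.memLp.intervalIntegrable_sq τ b), mul_add]
  exact add_le_add hl hr

/-! ### Piecewise-constant interpolation -/

lemma eLpNorm_two_sq {α E : Type*} [MeasurableSpace α] [ENorm E] (μ : Measure α) (f : α → E) :
    eLpNorm f 2 μ ^ 2 = ∫⁻ x, ‖f x‖ₑ ^ 2 ∂μ := by
  simpa using eLpNorm_nnreal_pow_eq_lintegral (f := f) (μ := μ) (p := 2) two_ne_zero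

/-- The left end `s_m = (t_{m-1} + t_m) / 2` of the cell of the instant `t_m`. -/
def cellStart (t : ℤ → ℝ) (m : ℤ) : ℝ := (t (m - 1) + t m) / 2

/-- The half-open cell `(s_m, s_{m+1}]` of the instant `t_m`. These cells partition the line,
whereas the closed ones share their end points. -/
def cell (t : ℤ → ℝ) (m : ℤ) : Set ℝ := Ioc (cellStart t m) (cellStart t (m + 1))

section Cells

variable {t : ℤ → ℝ}

lemma cellStart_add_one (t : ℤ → ℝ) (m : ℤ) : cellStart t (m + 1) = (t m + t (m + 1)) / 2 := by
  simp [cellStart]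

lemma strictMono_cellStart (ht : StrictMono t) : StrictMono (cellStart t) := by
  intro m n hmn
  have h1 := ht hmn
  have h2 := ht (show m - 1 < n - 1 by omega)
  unfold cellStart
  linarith

lemma cellStart_lt (ht : StrictMono t) (m : ℤ) : cellStart t m < t m := by
  have := ht (sub_one_lt m)
  unfold cellStart
  linarith

lemma lt_cellStart_add_one (ht : StrictMono t) (m : ℤ) : t m < cellStart t (m + 1) := by
  have := ht (lt_add_one m)
  rw [cellStart_add_one]
  linarith

lemma pairwise_disjoint_cell (ht : StrictMono t) : Pairwise (Function.onFun Disjoint (cell t)) :=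
  (strictMono_cellStart ht).monotone.pairwise_disjoint_on_Ioc_succ

lemma measurableSet_cell (t : ℤ → ℝ) (m : ℤ) : MeasurableSet (cell t m) := measurableSet_Ioc

lemma iUnion_cell (ht : StrictMono t) (htop : Tendsto t atTop atTop)
    (hbot : Tendsto t atBot atBot) : ⋃ m, cell t m = univ := by
  refine eq_univ_of_forall fun x => mem_iUnion.2 ?_
  obtain ⟨N, hN⟩ := (htop.eventually_ge_atTop x).exists
  obtain ⟨M, hM⟩ := (hbot.eventually_lt_atBot x).exists
  obtain ⟨m, hm, hmax⟩ := Int.exists_greatest_of_bdd (P := fun m => cellStart t m < x)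
    ⟨N, fun z hz => by
      by_contra! hlt
      have h1 := (strictMono_cellStart ht).monotone (show N + 1 ≤ z by omega)
      have h2 := lt_cellStart_add_one ht N
      linarith⟩ ⟨M, (cellStart_lt ht M).trans hM⟩
  refine ⟨m, hm, ?_⟩
  by_contra! hlt
  exact absurd (hmax _ hlt) (by omega)

lemma ae_of_forall_cell (ht : StrictMono t) (htop : Tendsto t atTop atTop)
    (hbot : Tendsto t atBot atBot) {P : ℝ → Prop}
    (h : ∀ m, ∀ᵐ x ∂volume.restrict (cell t m), P x) : ∀ᵐ x, P x := by
  rw [← Measure.restrict_univ (μ := (volume : Measure ℝ)), ← iUnion_cell ht htop hbot,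
    ae_restrict_iUnion_eq]
  exact eventually_iSup.2 h

lemma piecewiseConstant_eq_of_mem (ht : StrictMono t) (y : ℤ → ℝ) {m : ℤ} {x : ℝ}
    (hx : x ∈ Ioo (cellStart t m) (cellStart t (m + 1))) : piecewiseConstant t y x = y m := by
  have hs := (strictMono_cellStart ht).monotone
  unfold piecewiseConstant
  rw [tsum_eq_single m]
  · refine indicator_of_mem ?_ _
    rw [cellStart_add_one] at hx
    exact Ioo_subset_Icc_self hx
  · intro n hn
    refine indicator_of_notMem ?_ _
    rw [← cellStart_add_one]
    intro hxn
    rcases lt_or_gt_of_ne hn with h | h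
    · have := hs (show n + 1 ≤ m by omega)
      linarith [hx.1, hxn.2]
    · have := hs (show m + 1 ≤ n by omega)
      have h1 : cellStart t n ≤ x := hxn.1
      linarith [hx.2]

lemma piecewiseConstant_ae_eq (ht : StrictMono t) (y : ℤ → ℝ) (m : ℤ) :
    ∀ᵐ x ∂volume.restrict (cell t m), piecewiseConstant t y x = y m := by
  rw [cell, ← restrict_Ioo_eq_restrict_Ioc, ae_restrict_iff' measurableSet_Ioo]
  exact ae_of_all _ fun x hx => piecewiseConstant_eq_of_mem ht y hx

lemma aestronglyMeasurable_piecewiseConstant (ht : StrictMono t) (htop : Tendsto t atTop atTop)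
    (hbot : Tendsto t atBot atBot) (y : ℤ → ℝ) :
    AEStronglyMeasurable (piecewiseConstant t y) volume := by
  rw [← Measure.restrict_univ (μ := (volume : Measure ℝ)), ← iUnion_cell ht htop hbot,
    aestronglyMeasurable_iUnion_iff]
  intro m
  exact aestronglyMeasurable_const.congr (EventuallyEq.symm (piecewiseConstant_ae_eq ht y m))

lemma piecewiseConstant_sub_ae (ht : StrictMono t) (htop : Tendsto t atTop atTop)
    (hbot : Tendsto t atBot atBot) (y z : ℤ → ℝ) :
    piecewiseConstant t y - piecewiseConstant t z =ᵐ[volume]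
      piecewiseConstant t (fun m => y m - z m) := by
  refine ae_of_forall_cell ht htop hbot fun m => ?_
  filter_upwards [piecewiseConstant_ae_eq ht y m, piecewiseConstant_ae_eq ht z m,
    piecewiseConstant_ae_eq ht (fun m => y m - z m) m] with x h1 h2 h3
  rw [Pi.sub_apply, h1, h2, h3]

lemma lintegral_eq_tsum_cell (ht : StrictMono t) (htop : Tendsto t atTop atTop)
    (hbot : Tendsto t atBot atBot) (F : ℝ → ℝ≥0∞) :
    ∫⁻ x, F x = ∑' m, ∫⁻ x in cell t m, F x := by
  rw [← lintegral_iUnion (measurableSet_cell t) (pairwise_disjoint_cell ht),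
    iUnion_cell ht htop hbot, Measure.restrict_univ]

end Cells

lemma lintegral_Ioc_enorm_sq {w : ℝ → ℝ} {a b : ℝ} (hab : a ≤ b)
    (hw : IntervalIntegrable (fun x => w x ^ 2) volume a b) :
    ∫⁻ x in Ioc a b, ‖w x‖ₑ ^ 2 = ENNReal.ofReal (∫ x in a..b, w x ^ 2) := by
  rw [intervalIntegral.integral_of_le hab, ofReal_integral_eq_lintegral_ofReal
    ((intervalIntegrable_iff_integrableOn_Ioc_of_le hab).1 hw) (ae_of_all _ fun x => sq_nonneg _)]
  refine lintegral_congr fun x => ?_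
  rw [← sq_abs, ENNReal.ofReal_pow (abs_nonneg _), Real.enorm_eq_ofReal_abs]

/-- The distance between a function and its piecewise-constant interpolation: Wirtinger's
inequality on each cell, summed over the cells. -/
lemma HasL2Deriv.eLpNorm_sub_piecewiseConstant_le {f v : ℝ → ℝ} (hf : HasL2Deriv f v) {t : ℤ → ℝ}
    (ht : StrictMono t) (htop : Tendsto t atTop atTop) (hbot : Tendsto t atBot atBot)
    (hfin : samplingDensity t ≠ ∞) :
    eLpNorm (f - piecewiseConstant t fun m => f (t m)) 2 volume
      ≤ samplingDensity t / ENNReal.ofReal Real.pi * eLpNorm v 2 volume := by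
  set d := (samplingDensity t).toReal with hd
  have hgap : ∀ m, t (m + 1) - t m ≤ d := fun m => by
    have h1 : ENNReal.ofReal |t (m + 1) - t m| ≤ samplingDensity t :=
      le_iSup (fun m : ℤ => ENNReal.ofReal |t (m + 1) - t m|) m
    exact (le_abs_self _).trans ((ENNReal.ofReal_le_iff_le_toReal hfin).1 h1)
  have hdpos : 0 < d := lt_of_lt_of_le (sub_pos.2 (ht (lt_add_one (0 : ℤ)))) (hgap 0)
  have hcoef : samplingDensity t / ENNReal.ofReal Real.pi = ENNReal.ofReal (d / Real.pi) := by
    rw [ENNReal.ofReal_div_of_pos Real.pi_pos, hd, ENNReal.ofReal_toReal hfin]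
  rw [hcoef, ← ENNReal.pow_le_pow_left_iff two_ne_zero, mul_pow, eLpNorm_two_sq, eLpNorm_two_sq,
    lintegral_eq_tsum_cell ht htop hbot, lintegral_eq_tsum_cell ht htop hbot,
    ← ENNReal.tsum_mul_left]
  refine ENNReal.tsum_le_tsum fun m => ?_
  have hle : cellStart t m ≤ cellStart t (m + 1) := (strictMono_cellStart ht (lt_add_one m)).le
  calc ∫⁻ x in cell t m, ‖(f - piecewiseConstant t fun m => f (t m)) x‖ₑ ^ 2
      = ∫⁻ x in cell t m, ‖f x - f (t m)‖ₑ ^ 2 := by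
        refine lintegral_congr_ae ?_
        filter_upwards [piecewiseConstant_ae_eq ht (fun m => f (t m)) m] with x hx
        rw [Pi.sub_apply, hx]
    _ = ENNReal.ofReal (∫ x in cellStart t m..cellStart t (m + 1), (f x - f (t m)) ^ 2) :=
        lintegral_Ioc_enorm_sq hle
          (((hf.continuous.sub continuous_const).pow 2).intervalIntegrable _ _)
    _ ≤ ENNReal.ofReal ((d / Real.pi) ^ 2 *
          ∫ x in cellStart t m..cellStart t (m + 1), v x ^ 2) := by
        refine ENNReal.ofReal_le_ofReal (hf.integral_sq_sub_le (cellStart_lt ht m).le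
          (lt_cellStart_add_one ht m).le hdpos ?_ ?_)
        · have := hgap (m - 1)
          rw [sub_add_cancel] at this
          unfold cellStart
          linarith
        · have := hgap m
          rw [cellStart_add_one]
          linarith
    _ = _ := by
        rw [ENNReal.ofReal_mul (sq_nonneg _), ENNReal.ofReal_pow (by positivity), cell,
          lintegral_Ioc_enorm_sq hle (hf.memLp.intervalIntegrable_sq _ _)]

/-! ### Samples of Sobolev functions -/

lemma hasSum_integral_sub_intCast {w : ℝ → ℝ} (hw : Integrable w) (x : ℝ) :
    HasSum (fun k : ℤ => ∫ y in (x - k)..(x - k) + 1, w y) (∫ y, w y) := by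
  have h := (Equiv.neg ℤ).hasSum_iff.2 (hw.hasSum_intervalIntegral x)
  refine h.congr_fun ?_
  intro k
  simp [sub_eq_add_neg]

namespace HasL2Deriv

variable {φ v : ℝ → ℝ}

/-- Sampling bound for a function of the Sobolev space `H¹`: averaging over a unit interval. -/
lemma sq_le_integral_add_integral (hd : HasL2Deriv φ v) (hφ : MemLp φ 2 volume) (a : ℝ) :
    φ a ^ 2 ≤ 2 * (∫ x in a..a + 1, φ x ^ 2) + 2 * ∫ x in a..a + 1, v x ^ 2 := by
  have hle : a ≤ a + 1 := by linarith
  have hpt : ∀ y ∈ Icc a (a + 1), φ a ^ 2 ≤ 2 * φ y ^ 2 + 2 * ∫ x in a..a + 1, v x ^ 2 := by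
    intro y hy
    have h1 := hd.sq_sub_le hy.1
    have h2 : ∫ x in a..y, v x ^ 2 ≤ ∫ x in a..a + 1, v x ^ 2 :=
      intervalIntegral.integral_mono_interval le_rfl hy.1 hy.2 (ae_of_all _ fun x => sq_nonneg _)
        (hd.memLp.intervalIntegrable_sq _ _)
    have h3 : 0 ≤ ∫ x in a..y, v x ^ 2 :=
      intervalIntegral.integral_nonneg hy.1 fun x _ => sq_nonneg _
    have h4 : (y - a) * ∫ x in a..y, v x ^ 2 ≤ 1 * ∫ x in a..y, v x ^ 2 :=
      mul_le_mul_of_nonneg_right (by linarith [hy.2]) h3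
    nlinarith [sq_nonneg (2 * φ y - φ a)]
  have hint := intervalIntegral.integral_mono_on (μ := volume) hle (by simp)
    (((hφ.intervalIntegrable_sq a (a + 1)).const_mul 2).add (by simp)) hpt
  rw [intervalIntegral.integral_add ((hφ.intervalIntegrable_sq a (a + 1)).const_mul 2) (by simp),
    intervalIntegral.integral_const_mul] at hint
  simpa using hint

lemma summable_sq (hd : HasL2Deriv φ v) (hφ : MemLp φ 2 volume) (x : ℝ) :
    Summable fun k : ℤ => φ (x - k) ^ 2 := by
  refine Summable.of_nonneg_of_le (fun k => sq_nonneg _)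
    (fun k => hd.sq_le_integral_add_integral hφ (x - k)) ?_
  exact ((hasSum_integral_sub_intCast hφ.integrable_sq x).summable.mul_left 2).add
    ((hasSum_integral_sub_intCast hd.memLp.integrable_sq x).summable.mul_left 2)

/-- The samples `(φ(x - k))_k` form an `ℓ²` sequence that depends on `x` in a
`1/2`-Hölder continuous way. -/
lemma exists_uniformContinuous_samples (hd : HasL2Deriv φ v) (hφ : MemLp φ 2 volume) :
    ∃ b : ℝ → lp (fun _ : ℤ => ℝ) 2, UniformContinuous b ∧ ∀ x (k : ℤ), b x k = φ (x - k) := by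
  have hmem : ∀ x : ℝ, Memℓp (fun k : ℤ => φ (x - k)) 2 := fun x =>
    memℓp_gen (by simpa using hd.summable_sq hφ x)
  set b : ℝ → lp (fun _ : ℤ => ℝ) 2 := fun x => ⟨_, hmem x⟩ with hb
  have hbk : ∀ x (k : ℤ), b x k = φ (x - k) := fun x k => rfl
  refine ⟨b, ?_, hbk⟩
  set M := ∫ y, v y ^ 2 with hM
  have hM0 : 0 ≤ M := integral_nonneg fun y => sq_nonneg _
  have hle : ∀ x y : ℝ, x ≤ y → y ≤ x + 1 → ‖b y - b x‖ ^ 2 ≤ (y - x) * M := by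
    intro x y hxy hyx
    have hs := (hasSum_integral_sub_intCast hd.memLp.integrable_sq x).mul_left (y - x)
    have hterm : ∀ k : ℤ, (b y - b x) k ^ 2
        ≤ (y - x) * ∫ z in (x - k)..(x - k) + 1, v z ^ 2 := by
      intro k
      have h1 := hd.sq_sub_le (show x - k ≤ y - k by linarith)
      have h2 : ∫ z in (x - k)..(y - k), v z ^ 2 ≤ ∫ z in (x - k)..(x - k) + 1, v z ^ 2 :=
        intervalIntegral.integral_mono_interval le_rfl (by linarith) (by linarith)
          (ae_of_all _ fun x => sq_nonneg _) (hd.memLp.intervalIntegrable_sq _ _)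
      have h3 := mul_le_mul_of_nonneg_left h2 (sub_nonneg.2 hxy)
      rw [lp.coeFn_sub, Pi.sub_apply, hbk, hbk]
      rw [sub_sub_sub_cancel_right] at h1
      exact h1.trans h3
    have hn := lp.norm_rpow_eq_tsum (p := 2) (by norm_num) (b y - b x)
    simp only [ENNReal.toReal_ofNat, Real.rpow_ofNat, Real.norm_eq_abs, sq_abs] at hn
    rw [hn]
    have hsum : Summable fun k : ℤ => (b y - b x) k ^ 2 :=
      Summable.of_nonneg_of_le (fun k => sq_nonneg _) hterm hs.summable
    exact (hsum.tsum_le_tsum hterm hs.summable).trans hs.tsum_eq.le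
  rw [Metric.uniformContinuous_iff]
  intro ε hε
  have key : ∀ x y : ℝ, x ≤ y → y - x < min 1 (ε ^ 2 / (M + 1)) → dist (b y) (b x) < ε := by
    intro x y hxy hlt
    have h1 := hle x y hxy (by linarith [hlt.trans_le (min_le_left _ _)])
    have h2 : (y - x) * (M + 1) < ε ^ 2 :=
      (lt_div_iff₀ (by linarith)).1 (hlt.trans_le (min_le_right _ _))
    rw [dist_eq_norm]
    refine lt_of_pow_lt_pow_left₀ 2 hε.le ?_
    nlinarith
  refine ⟨min 1 (ε ^ 2 / (M + 1)), lt_min one_pos (by positivity), fun {x y} hxy => ?_⟩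
  rw [Real.dist_eq] at hxy
  rcases le_total x y with h | h
  · rw [dist_comm]
    exact key x y h ((le_abs_self _).trans_lt (by rwa [abs_sub_comm] at hxy))
  · exact key y x h ((le_abs_self _).trans_lt hxy)

end HasL2Deriv

section ScaledKernel

variable {φ : ℝ → ℝ} {h : ℝ}

lemma scaledKernel_sub_mul (φ : ℝ → ℝ) (hh : 0 < h) (t : ℝ) (k : ℤ) :
    scaledKernel φ h (t - h * k) = φ (t / h - k) := by
  unfold scaledKernel
  congr 1
  field_simp

lemma exists_uniformContinuous_samples_scaledKernel {v : ℝ → ℝ} (hd : HasL2Deriv φ v)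
    (hφ : MemLp φ 2 volume) (hh : 0 < h) :
    ∃ b : ℝ → lp (fun _ : ℤ => ℝ) 2, UniformContinuous b ∧
      ∀ t (k : ℤ), b t k = scaledKernel φ h (t - h * k) := by
  obtain ⟨b, hb, hbk⟩ := hd.exists_uniformContinuous_samples hφ
  refine ⟨fun t => b (t / h), hb.comp ?_, fun t k => ?_⟩
  · simpa only [div_eq_inv_mul] using Real.uniformContinuous_const_mul (x := h⁻¹)
  · rw [hbk, scaledKernel_sub_mul φ hh]

lemma MeasureTheory.MemLp.comp_div {w : ℝ → ℝ} (hw : MemLp w 2 volume) (hh : 0 < h) :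
    MemLp (fun t => w (t / h)) 2 volume := by
  have hm : Measurable fun t : ℝ => t / h := by fun_prop
  have hmap : Measure.map (fun t : ℝ => t / h) volume = ENNReal.ofReal |h| • volume := by
    have := Real.map_volume_mul_right (inv_ne_zero hh.ne')
    simpa [div_eq_mul_inv] using this
  refine (memLp_map_measure_iff (f := fun t : ℝ => t / h) (g := w) ?_ hm.aemeasurable).1 ?_
  · rw [hmap]
    exact hw.aestronglyMeasurable.smul_measure _
  · rw [hmap]
    exact hw.smul_measure ENNReal.ofReal_ne_top

lemma deriv_scaledKernel (φ : ℝ → ℝ) (h : ℝ) :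
    deriv (scaledKernel φ h) = fun t => h⁻¹ * deriv φ (t / h) := by
  ext t
  have := deriv_comp_mul_left h⁻¹ φ t
  have heq : scaledKernel φ h = fun x => φ (h⁻¹ * x) := funext fun x => by
    rw [scaledKernel, div_eq_inv_mul]
  rw [heq, this, div_eq_inv_mul, smul_eq_mul]

lemma hasL2Deriv_scaledKernel (hac : ∀ a b : ℝ, AbsolutelyContinuousOnInterval φ a b)
    (hDφ : MemLp (deriv φ) 2 volume) (hh : 0 < h) :
    HasL2Deriv (scaledKernel φ h) (deriv (scaledKernel φ h)) := by
  rw [deriv_scaledKernel]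
  refine ⟨(hDφ.comp_div hh).const_mul _, fun a b => ?_⟩
  rw [intervalIntegral.integral_const_mul, intervalIntegral.integral_comp_div _ hh.ne',
    (hac _ _).integral_deriv_eq_sub, smul_eq_mul, inv_mul_cancel_left₀ hh.ne']
  rfl

end ScaledKernel

/-! ### The Fourier transform of finite sums of shifts -/

/-- The pure frequency `ξ ↦ e^{-2π i a ξ}`. -/
def phase (a ξ : ℝ) : ℂ := (Real.fourierChar (-(a * ξ)) : ℂ)

lemma continuous_phase (a : ℝ) : Continuous (phase a) := by
  unfold phase
  exact continuous_subtype_val.comp (Real.continuous_fourierChar.comp (by fun_prop))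

lemma norm_phase (a ξ : ℝ) : ‖phase a ξ‖ = 1 := Circle.norm_coe _

lemma memLp_phase_mul (a : ℝ) {F : ℝ → ℂ} (hF : MemLp F 2 volume) :
    MemLp (fun ξ => phase a ξ * F ξ) 2 volume :=
  hF.of_le ((continuous_phase a).aestronglyMeasurable.mul hF.aestronglyMeasurable)
    (ae_of_all _ fun ξ => by rw [norm_mul, norm_phase, one_mul])

lemma isometry_phase_mul (a : ℝ) : Isometry fun F : Lp ℂ 2 (volume : Measure ℝ) =>
    (memLp_phase_mul a (Lp.memLp F)).toLp (fun ξ => phase a ξ * F ξ) := by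
  refine Isometry.of_dist_eq fun F G => ?_
  rw [Lp.dist_def, Lp.dist_def]
  congr 1
  refine eLpNorm_congr_norm_ae ?_
  filter_upwards [(memLp_phase_mul a (Lp.memLp F)).coeFn_toLp,
    (memLp_phase_mul a (Lp.memLp G)).coeFn_toLp] with ξ h1 h2
  rw [Pi.sub_apply, Pi.sub_apply, h1, h2, ← mul_sub, norm_mul, norm_phase, one_mul]

lemma SchwartzMap.fourier_translate (S : SchwartzMap ℝ ℂ) (a ξ : ℝ) :
    𝓕 (S.compSubConstCLM ℂ a) ξ = phase a ξ * 𝓕 S ξ := by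
  have h := congrFun (VectorFourier.fourierIntegral_comp_add_right Real.fourierChar volume
    (innerₗ ℝ) (S : ℝ → ℂ) (-a)) ξ
  rw [SchwartzMap.fourier_coe, SchwartzMap.fourier_coe]
  have h2 : (⇑(S.compSubConstCLM ℂ a) : ℝ → ℂ) = (S : ℝ → ℂ) ∘ fun x => x + -a := by
    ext x
    simp [sub_eq_add_neg]
  rw [h2]
  refine h.trans ?_
  rw [Circle.smul_def, smul_eq_mul, phase]
  congr 3
  simp [mul_comm]

/-- Translation on the time side is modulation on the frequency side. Both sides are isometric
in the function, so that it suffices to look at Schwartz functions. -/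
lemma fourier_compMeasurePreserving_sub (a : ℝ) (F : Lp ℂ 2 (volume : Measure ℝ)) :
    𝓕 (Lp.compMeasurePreserving (fun x : ℝ => x - a) (measurePreserving_sub_right volume a) F)
      = (memLp_phase_mul a (Lp.memLp (𝓕 F))).toLp (fun ξ => phase a ξ * (𝓕 F : Lp ℂ 2 _) ξ) := by
  refine DenseRange.induction_on (p := fun F : Lp ℂ 2 (volume : Measure ℝ) =>
    𝓕 (Lp.compMeasurePreserving (fun x : ℝ => x - a) (measurePreserving_sub_right volume a) F)
      = (memLp_phase_mul a (Lp.memLp (𝓕 F))).toLp (fun ξ => phase a ξ * (𝓕 F : Lp ℂ 2 _) ξ))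
    (SchwartzMap.denseRange_toLpCLM (p := 2) ENNReal.ofNat_ne_top) F ?_ ?_
  · refine isClosed_eq ?_ ?_
    · exact (Lp.fourierTransformₗᵢ ℝ ℂ).continuous.comp
        (Lp.compMeasurePreservingₗᵢ ℂ (fun x : ℝ => x - a)
          (measurePreserving_sub_right volume a)).continuous
    · exact (isometry_phase_mul a).continuous.comp (Lp.fourierTransformₗᵢ ℝ ℂ).continuous
  · intro S
    have hS : ∀ᵐ x ∂(volume : Measure ℝ), S.toLp 2 volume x = S x := S.coeFn_toLp 2 volume
    have h1 : Lp.compMeasurePreserving (fun x : ℝ => x - a) (measurePreserving_sub_right volume a)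
        (S.toLp 2) = (S.compSubConstCLM ℂ a).toLp 2 := by
      ext1
      filter_upwards [Lp.coeFn_compMeasurePreserving (S.toLp 2)
        (measurePreserving_sub_right (volume : Measure ℝ) a),
        (S.compSubConstCLM ℂ a).coeFn_toLp 2,
        (measurePreserving_sub_right (volume : Measure ℝ) a).quasiMeasurePreserving.ae
          hS] with x h1 h2 h3
      rw [h1, h2, Function.comp_apply, h3]
      rfl
    change 𝓕 (Lp.compMeasurePreserving (fun x : ℝ => x - a)
      (measurePreserving_sub_right volume a) (S.toLp 2)) = _
    rw [h1, SchwartzMap.toLp_fourier_eq]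
    ext1
    have h4 : (𝓕 (S.toLp 2) : Lp ℂ 2 (volume : Measure ℝ)) = (𝓕 S).toLp 2 :=
      SchwartzMap.toLp_fourier_eq S
    filter_upwards [(𝓕 (S.compSubConstCLM ℂ a)).coeFn_toLp 2, (𝓕 S).coeFn_toLp 2,
      (memLp_phase_mul a (Lp.memLp (𝓕 (S.toLp 2)))).coeFn_toLp] with ξ h1 h2 h3
    refine h1.trans (Eq.trans ?_ h3.symm)
    rw [SchwartzMap.fourier_translate, h4, h2]

/-- A finite sum `∑_{k ∈ s} c_k g(· - h k)` of shifts. -/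
def finSynthesis (g : ℝ → ℝ) (h : ℝ) (c : ℤ → ℝ) (s : Finset ℤ) (t : ℝ) : ℝ :=
  ∑ k ∈ s, c k * g (t - h * k)

/-- The trigonometric polynomial `∑_{k ∈ s} c_k e^{-i h k ω}` in the angular frequency `ω`. -/
def trigPoly (h : ℝ) (c : ℤ → ℝ) (s : Finset ℤ) (ω : ℝ) : ℂ :=
  ∑ k ∈ s, (c k : ℂ) * phase (h * k) (ω / (2 * Real.pi))

lemma continuous_trigPoly (h : ℝ) (c : ℤ → ℝ) (s : Finset ℤ) : Continuous (trigPoly h c s) :=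
  continuous_finsetSum _ fun _ _ =>
    continuous_const.mul ((continuous_phase _).comp (continuous_id.div_const _))

lemma trigPoly_add_period {h : ℝ} (hh : 0 < h) (c : ℤ → ℝ) (s : Finset ℤ) (ω : ℝ) (n : ℤ) :
    trigPoly h c s (ω + 2 * Real.pi * n / h) = trigPoly h c s ω := by
  refine Finset.sum_congr rfl fun k _ => ?_
  congr 1
  have hpi := Real.pi_ne_zero
  unfold phase
  rw [Real.fourierChar_apply, Real.fourierChar_apply, Complex.exp_eq_exp_iff_exists_int]
  refine ⟨-(k * n), ?_⟩
  push_cast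
  have : (Real.pi : ℂ) ≠ 0 := by exact_mod_cast hpi
  have : (h : ℂ) ≠ 0 := by exact_mod_cast hh.ne'
  field_simp
  ring

lemma memLp_ofReal {g : ℝ → ℝ} (hg : MemLp g 2 volume) :
    MemLp (fun t => (g t : ℂ)) 2 volume := hg.ofReal

lemma memLp_finSynthesis {g : ℝ → ℝ} (hg : MemLp g 2 volume) (h : ℝ) (c : ℤ → ℝ) (s : Finset ℤ) :
    MemLp (finSynthesis g h c s) 2 volume :=
  memLp_finsetSum s fun k _ =>
    (hg.comp_measurePreserving (measurePreserving_sub_right volume (h * k))).const_mul (c k)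

lemma angularFourier_of_memLp {g : ℝ → ℝ} (hg : MemLp g 2 volume) (ω : ℝ) :
    angularFourier g ω = (𝓕 ((memLp_ofReal hg).toLp (fun t => (g t : ℂ))) :
      Lp ℂ 2 (volume : Measure ℝ)) (ω / (2 * Real.pi)) := by
  rw [angularFourier, dif_pos (memLp_ofReal hg)]

lemma fourier_toLp_translate_ae {g : ℝ → ℝ} (hg : MemLp g 2 volume) (a c : ℝ)
    (hg' : MemLp (fun t => c * g (t - a)) 2 volume) :
    (𝓕 ((memLp_ofReal hg').toLp (fun t => ((c * g (t - a) : ℝ) : ℂ))) :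
        Lp ℂ 2 (volume : Measure ℝ)) =ᵐ[volume]
      fun ξ => c * phase a ξ *
        (𝓕 ((memLp_ofReal hg).toLp (fun t => (g t : ℂ))) : Lp ℂ 2 (volume : Measure ℝ)) ξ := by
  have h1 : (memLp_ofReal hg').toLp (fun t => ((c * g (t - a) : ℝ) : ℂ))
      = (c : ℂ) • Lp.compMeasurePreserving (fun x : ℝ => x - a)
          (measurePreserving_sub_right volume a)
          ((memLp_ofReal hg).toLp (fun t => (g t : ℂ))) := by
    ext1
    filter_upwards [(memLp_ofReal hg').coeFn_toLp,
      Lp.coeFn_smul (c : ℂ) (Lp.compMeasurePreserving (fun x : ℝ => x - a)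
          (measurePreserving_sub_right volume a)
          ((memLp_ofReal hg).toLp (fun t => (g t : ℂ)))),
      Lp.coeFn_compMeasurePreserving ((memLp_ofReal hg).toLp (fun t => (g t : ℂ)))
        (measurePreserving_sub_right (volume : Measure ℝ) a),
      (measurePreserving_sub_right (volume : Measure ℝ) a).quasiMeasurePreserving.ae
        (memLp_ofReal hg).coeFn_toLp] with x h1 h2 h3 h4
    rw [h1, h2, Pi.smul_apply, h3, Function.comp_apply, h4]
    push_cast
    rfl
  rw [h1, FourierTransform.fourier_smul, fourier_compMeasurePreserving_sub]
  filter_upwards [Lp.coeFn_smul (c : ℂ) ((memLp_phase_mul a (Lp.memLp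
      (𝓕 ((memLp_ofReal hg).toLp (fun t => (g t : ℂ)))))).toLp _),
    (memLp_phase_mul a (Lp.memLp
      (𝓕 ((memLp_ofReal hg).toLp (fun t => (g t : ℂ)))))).coeFn_toLp] with ξ h1 h2
  rw [h1, Pi.smul_apply, h2, smul_eq_mul, mul_assoc]

lemma fourier_toLp_finSynthesis_ae {g : ℝ → ℝ} (hg : MemLp g 2 volume) (h : ℝ) (c : ℤ → ℝ)
    (s : Finset ℤ) :
    (𝓕 ((memLp_ofReal (memLp_finSynthesis hg h c s)).toLp
        (fun t => (finSynthesis g h c s t : ℂ))) : Lp ℂ 2 (volume : Measure ℝ)) =ᵐ[volume]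
      fun ξ => (∑ k ∈ s, (c k : ℂ) * phase (h * k) ξ) *
        (𝓕 ((memLp_ofReal hg).toLp (fun t => (g t : ℂ))) : Lp ℂ 2 (volume : Measure ℝ)) ξ := by
  classical
  induction s using Finset.induction_on with
  | empty =>
    have h0 : (memLp_ofReal (memLp_finSynthesis hg h c ∅)).toLp
        (fun t => (finSynthesis g h c ∅ t : ℂ)) = 0 := by
      ext1
      filter_upwards [(memLp_ofReal (memLp_finSynthesis hg h c ∅)).coeFn_toLp,
        Lp.coeFn_zero ℂ 2 (volume : Measure ℝ)] with x h1 h2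
      rw [h1, h2]
      simp [finSynthesis]
    have h1 : (𝓕 (0 : Lp ℂ 2 (volume : Measure ℝ)) : Lp ℂ 2 (volume : Measure ℝ)) = 0 :=
      (Lp.fourierTransformₗᵢ ℝ ℂ).map_zero
    rw [h0, h1]
    filter_upwards [Lp.coeFn_zero ℂ 2 (volume : Measure ℝ)] with x h2
    rw [h2]
    simp
  | insert k s hk ih =>
    have hk' : MemLp (fun t => c k * g (t - h * k)) 2 volume :=
      (hg.comp_measurePreserving (measurePreserving_sub_right volume (h * k))).const_mul (c k)
    have h0 : (memLp_ofReal (memLp_finSynthesis hg h c (insert k s))).toLp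
        (fun t => (finSynthesis g h c (insert k s) t : ℂ))
        = (memLp_ofReal hk').toLp (fun t => ((c k * g (t - h * k) : ℝ) : ℂ))
          + (memLp_ofReal (memLp_finSynthesis hg h c s)).toLp
            (fun t => (finSynthesis g h c s t : ℂ)) := by
      rw [← MemLp.toLp_add]
      refine MemLp.toLp_congr _ _ (ae_of_all _ fun t => ?_)
      simp [finSynthesis, Finset.sum_insert hk]
    rw [h0, FourierTransform.fourier_add]
    filter_upwards [ih, fourier_toLp_translate_ae hg (h * k) (c k) hk',
      Lp.coeFn_add (𝓕 ((memLp_ofReal hk').toLp (fun t => ((c k * g (t - h * k) : ℝ) : ℂ))))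
        (𝓕 ((memLp_ofReal (memLp_finSynthesis hg h c s)).toLp
            (fun t => (finSynthesis g h c s t : ℂ))))] with ξ h1 h2 h3
    rw [h3, Pi.add_apply, h1, h2, Finset.sum_insert hk]
    ring

/-! ### Bernstein's inequality -/

/-- Plancherel's theorem for a finite sum of shifts, in angular frequency. -/
lemma two_pi_mul_eLpNorm_finSynthesis_sq {g : ℝ → ℝ} (hg : MemLp g 2 volume) (h : ℝ)
    (c : ℤ → ℝ) (s : Finset ℤ) :
    ENNReal.ofReal (2 * Real.pi) * eLpNorm (finSynthesis g h c s) 2 volume ^ 2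
      = ∫⁻ ω, ‖trigPoly h c s ω‖ₑ ^ 2 * ‖angularFourier g ω‖ₑ ^ 2 := by
  have hpi : (0 : ℝ) < 2 * Real.pi := by positivity
  set G : Lp ℂ 2 (volume : Measure ℝ) := 𝓕 ((memLp_ofReal hg).toLp (fun t => (g t : ℂ))) with hG
  set U := (memLp_ofReal (memLp_finSynthesis hg h c s)).toLp
    (fun t => (finSynthesis g h c s t : ℂ)) with hU
  have h1 : eLpNorm (finSynthesis g h c s) 2 volume = ‖(𝓕 U : Lp ℂ 2 (volume : Measure ℝ))‖ₑ := by
    have h2 : ‖(𝓕 U : Lp ℂ 2 (volume : Measure ℝ))‖ₑ = ‖U‖ₑ := by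
      rw [← ofReal_norm, ← ofReal_norm, Lp.norm_fourier_eq]
    rw [h2, hU, Lp.enorm_toLp]
    exact eLpNorm_congr_norm_ae (ae_of_all _ fun t => (Complex.norm_real _).symm)
  have h3 : eLpNorm (finSynthesis g h c s) 2 volume ^ 2
      = ∫⁻ ξ, ‖∑ k ∈ s, (c k : ℂ) * phase (h * k) ξ‖ₑ ^ 2 * ‖G ξ‖ₑ ^ 2 := by
    rw [h1, Lp.enorm_def, eLpNorm_two_sq]
    refine lintegral_congr_ae ?_
    filter_upwards [fourier_toLp_finSynthesis_ae hg h c s] with ξ hξ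
    rw [hU, hξ, enorm_mul, mul_pow]
  -- the substitution `ω = 2 π ξ`
  have hmap : Measure.map (fun ω : ℝ => (2 * Real.pi)⁻¹ * ω) volume
      = ENNReal.ofReal (2 * Real.pi) • volume := by
    have := Real.map_volume_mul_left (inv_ne_zero hpi.ne')
    rwa [inv_inv, abs_of_pos hpi] at this
  have hemb : MeasurableEmbedding fun ω : ℝ => (2 * Real.pi)⁻¹ * ω :=
    (Homeomorph.mulLeft₀ _ (inv_ne_zero hpi.ne')).isClosedEmbedding.measurableEmbedding
  have h4 := hemb.lintegral_map (μ := volume)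
    (fun ξ => ‖∑ k ∈ s, (c k : ℂ) * phase (h * k) ξ‖ₑ ^ 2 * ‖G ξ‖ₑ ^ 2)
  rw [hmap, lintegral_smul_measure, smul_eq_mul, ← h3] at h4
  rw [h4]
  refine lintegral_congr fun ω => ?_
  rw [angularFourier_of_memLp hg, trigPoly, div_eq_inv_mul]

/-- Folding an integral over the line into one period. -/
lemma lintegral_eq_lintegral_Ioc_tsum {T : ℝ} (hT : 0 < T) (a : ℝ) {F : ℝ → ℝ≥0∞}
    (hF : Measurable F) :
    ∫⁻ x, F x = ∫⁻ x in Ioc a (a + T), ∑' n : ℤ, F (x + n • T) := by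
  have hFn : ∀ n : ℤ, AEMeasurable (fun x => F (x + n • T)) (volume.restrict (Ioc a (a + T))) :=
    fun n => (hF.comp (measurable_add_const _)).aemeasurable
  rw [lintegral_tsum hFn, ← setLIntegral_univ, ← iUnion_Ioc_add_zsmul hT a,
    lintegral_iUnion (fun n => measurableSet_Ioc) (pairwise_disjoint_Ioc_add_zsmul a T)]
  refine tsum_congr fun n => ?_
  rw [← (measurePreserving_add_right volume (n • T)).setLIntegral_comp_preimage_emb
    (measurableEmbedding_addRight _)]
  congr 2
  rw [preimage_add_const_Ioc]
  congr 1
  · simp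
  · simp [add_smul]; ring

lemma measurable_enorm_angularFourier {g : ℝ → ℝ} (hg : MemLp g 2 volume) :
    Measurable fun ω => ‖angularFourier g ω‖ₑ := by
  have heq : angularFourier g = fun ω => (𝓕 ((memLp_ofReal hg).toLp (fun t => (g t : ℂ))) :
      Lp ℂ 2 (volume : Measure ℝ)) (ω / (2 * Real.pi)) := funext (angularFourier_of_memLp hg)
  rw [heq]
  exact ((Lp.stronglyMeasurable _).measurable.comp (by fun_prop)).enorm

lemma autocorrelationSpectrum_sq (h : ℝ) (g : ℝ → ℝ) (ω : ℝ) :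
    autocorrelationSpectrum h g ω ^ 2
      = ∑' k : ℤ, ‖angularFourier g (ω + 2 * Real.pi * k / h)‖ₑ ^ 2 := by
  rw [autocorrelationSpectrum, ← ENNReal.rpow_natCast, ← ENNReal.rpow_mul]
  norm_num

/-- The `L²` norm of a finite sum of shifts, as an integral over one period in frequency. -/
lemma two_pi_mul_eLpNorm_finSynthesis_sq_eq_setLIntegral {g : ℝ → ℝ} (hg : MemLp g 2 volume)
    {h : ℝ} (hh : 0 < h) (c : ℤ → ℝ) (s : Finset ℤ) :
    ENNReal.ofReal (2 * Real.pi) * eLpNorm (finSynthesis g h c s) 2 volume ^ 2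
      = ∫⁻ ω in Ioc (-(Real.pi / h)) (Real.pi / h),
          ‖trigPoly h c s ω‖ₑ ^ 2 * autocorrelationSpectrum h g ω ^ 2 := by
  have hT : 0 < 2 * Real.pi / h := by positivity
  have hF : Measurable fun ω => ‖trigPoly h c s ω‖ₑ ^ 2 * ‖angularFourier g ω‖ₑ ^ 2 :=
    (((continuous_trigPoly h c s).measurable.enorm).pow_const 2).mul
      ((measurable_enorm_angularFourier hg).pow_const 2)
  rw [two_pi_mul_eLpNorm_finSynthesis_sq hg,
    lintegral_eq_lintegral_Ioc_tsum hT (-(Real.pi / h)) hF,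
    show -(Real.pi / h) + 2 * Real.pi / h = Real.pi / h by ring]
  refine lintegral_congr fun ω => ?_
  rw [autocorrelationSpectrum_sq, ← ENNReal.tsum_mul_left]
  refine tsum_congr fun n => ?_
  rw [show n • (2 * Real.pi / h) = 2 * Real.pi * n / h by rw [zsmul_eq_mul]; ring,
    trigPoly_add_period hh]

/-- Bernstein's inequality for finite sums of shifts: differentiation multiplies the integrand of
the frequency integral by at most the square of the spectral ratio. -/
lemma eLpNorm_finSynthesis_deriv_le {g : ℝ → ℝ} (hg : MemLp g 2 volume)
    (hg' : MemLp (deriv g) 2 volume) {h : ℝ} (hh : 0 < h) (h0 : spectralRatio h g ≠ 0)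
    (htop : spectralRatio h g ≠ ∞) (c : ℤ → ℝ) (s : Finset ℤ) :
    eLpNorm (finSynthesis (deriv g) h c s) 2 volume
      ≤ spectralRatio h g * eLpNorm (finSynthesis g h c s) 2 volume := by
  set S := spectralRatio h g with hS
  have hae : ∀ᵐ ω ∂volume.restrict (Ioc (-(Real.pi / h)) (Real.pi / h)),
      autocorrelationSpectrum h (deriv g) ω ≤ S * autocorrelationSpectrum h g ω := by
    have h1 : ∀ᵐ ω ∂volume.restrict (Icc (-(Real.pi / h)) (Real.pi / h)),
        autocorrelationSpectrum h (deriv g) ω / autocorrelationSpectrum h g ω ≤ S :=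
      ENNReal.ae_le_essSup _
    filter_upwards [ae_restrict_of_ae_restrict_of_subset Ioc_subset_Icc_self h1] with ω hω
    -- `0 / 0 = 0` and `x / ∞ = 0` are harmless because `S` is neither `∞` nor `0`
    exact (ENNReal.div_le_iff_le_mul (Or.inr htop) (Or.inr h0)).1 hω
  have hpi0 : ENNReal.ofReal (2 * Real.pi) ≠ 0 := by
    simp [Real.pi_pos]
  rw [← ENNReal.pow_le_pow_left_iff two_ne_zero, mul_pow,
    ← ENNReal.mul_le_mul_iff_right hpi0 ENNReal.ofReal_ne_top, mul_left_comm,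
    two_pi_mul_eLpNorm_finSynthesis_sq_eq_setLIntegral hg hh,
    two_pi_mul_eLpNorm_finSynthesis_sq_eq_setLIntegral hg' hh,
    ← lintegral_const_mul' _ _ (ENNReal.pow_ne_top htop)]
  refine lintegral_mono_ae ?_
  filter_upwards [hae] with ω hω
  rw [mul_left_comm, ← mul_pow S]
  gcongr

/-! ### The shift-invariant space and its orthogonal projection -/

section Synthesis

variable {g : ℝ → ℝ} {h : ℝ} {b : ℝ → lp (fun _ : ℤ => ℝ) 2}

lemma isSynthesis_inner (hb : ∀ t (k : ℤ), b t k = g (t - h * k))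
    (c : lp (fun _ : ℤ => ℝ) 2) : IsSynthesis g h c (fun t => inner ℝ c (b t)) := by
  intro t
  have := lp.hasSum_inner (𝕜 := ℝ) c (b t)
  refine this.congr_fun fun k => ?_
  rw [hb, real_inner_eq_re_inner]
  simp [mul_comm]

lemma IsSynthesis.eq_inner (hb : ∀ t (k : ℤ), b t k = g (t - h * k))
    {c : lp (fun _ : ℤ => ℝ) 2} {f : ℝ → ℝ} (hf : IsSynthesis g h c f) :
    f = fun t => inner ℝ c (b t) :=
  funext fun t => (hf t).unique (isSynthesis_inner hb c t)

lemma uniformContinuous_of_mem_shiftInvariantSpace (hbu : UniformContinuous b)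
    (hb : ∀ t (k : ℤ), b t k = g (t - h * k)) {f : ℝ → ℝ} (hf : f ∈ shiftInvariantSpace g h) :
    UniformContinuous f := by
  obtain ⟨c, hc⟩ := hf
  rw [hc.eq_inner hb]
  exact (innerSL ℝ c).uniformContinuous.comp hbu

lemma sub_mem_shiftInvariantSpace {f f' : ℝ → ℝ} (hf : f ∈ shiftInvariantSpace g h)
    (hf' : f' ∈ shiftInvariantSpace g h) : f - f' ∈ shiftInvariantSpace g h := by
  obtain ⟨c, hc⟩ := hf
  obtain ⟨c', hc'⟩ := hf'
  refine ⟨c - c', fun t => ?_⟩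
  simpa [sub_mul] using (hc t).sub (hc' t)

lemma memLp_of_mem_shiftInvariantSpace (hR : IsRieszGenerator g h) (hbu : UniformContinuous b)
    (hb : ∀ t (k : ℤ), b t k = g (t - h * k)) {f : ℝ → ℝ} (hf : f ∈ shiftInvariantSpace g h) :
    MemLp f 2 volume := by
  have hcont := (uniformContinuous_of_mem_shiftInvariantSpace hbu hb hf).continuous
  obtain ⟨A, B, -, -, hAB⟩ := hR
  obtain ⟨c, hc⟩ := hf
  exact ⟨hcont.aestronglyMeasurable, (hAB c f hc).2.trans_lt ENNReal.ofReal_lt_top⟩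

/-- The synthesis operator `c ↦ ∑ c_k g(· - h k)` embeds `ℓ²(ℤ)` as a closed subspace of `L²(ℝ)`,
by the two Riesz bounds. -/
lemma exists_synthesis_clm (hR : IsRieszGenerator g h) (hbu : UniformContinuous b)
    (hb : ∀ t (k : ℤ), b t k = g (t - h * k)) :
    ∃ T : lp (fun _ : ℤ => ℝ) 2 →L[ℝ] Lp ℝ 2 (volume : Measure ℝ),
      (∀ c, T c =ᵐ[volume] fun t => inner ℝ c (b t)) ∧ IsClosed (range T) := by
  have hmem : ∀ c : lp (fun _ : ℤ => ℝ) 2, MemLp (fun t => inner ℝ c (b t)) 2 volume := fun c =>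
    memLp_of_mem_shiftInvariantSpace hR hbu hb ⟨c, isSynthesis_inner hb c⟩
  obtain ⟨A, B, hA, hB, hAB⟩ := hR
  set L : lp (fun _ : ℤ => ℝ) 2 →ₗ[ℝ] Lp ℝ 2 (volume : Measure ℝ) :=
    { toFun := fun c => (hmem c).toLp _
      map_add' := fun c c' => by
        rw [← MemLp.toLp_add]
        exact MemLp.toLp_congr _ _ (ae_of_all _ fun t => by simp [inner_add_left])
      map_smul' := fun r c => by
        rw [RingHom.id_apply, ← MemLp.toLp_const_smul]
        exact MemLp.toLp_congr _ _ (ae_of_all _ fun t => by simp [inner_smul_left]) } with hL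
  have hnorm : ∀ c, ‖L c‖ = (eLpNorm (fun t => inner ℝ c (b t)) 2 volume).toReal := fun c =>
    Lp.norm_toLp _ (hmem c)
  have hup : ∀ c, ‖L c‖ ≤ B * ‖c‖ := fun c => by
    rw [hnorm]
    exact ENNReal.toReal_le_of_le_ofReal (by positivity) (hAB c _ (isSynthesis_inner hb c)).2
  have hlow : ∀ c, A * ‖c‖ ≤ ‖L c‖ := fun c => by
    rw [hnorm]
    exact (ENNReal.ofReal_le_iff_le_toReal (hmem c).2.ne).1 (hAB c _ (isSynthesis_inner hb c)).1
  refine ⟨L.mkContinuous B hup, fun c => (hmem c).coeFn_toLp, ?_⟩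
  have hanti : AntilipschitzWith (Real.toNNReal A⁻¹) (L.mkContinuous B hup) := by
    refine AddMonoidHomClass.antilipschitz_of_bound _ fun c => ?_
    rw [Real.coe_toNNReal _ (inv_nonneg.2 hA.le), inv_mul_eq_div, le_div_iff₀ hA, mul_comm]
    exact hlow c
  exact hanti.isClosed_range (L.mkContinuous B hup).uniformContinuous

lemma integral_sub_mul_eq_inner {u v w : ℝ → ℝ} (hu : MemLp u 2 volume) (hv : MemLp v 2 volume)
    (hw : MemLp w 2 volume) :
    ∫ x, (u x - v x) * w x = inner ℝ (hu.toLp u - hv.toLp v) (hw.toLp w) := by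
  rw [L2.inner_def]
  refine integral_congr_ae ?_
  filter_upwards [Lp.coeFn_sub (hu.toLp u) (hv.toLp v), hu.coeFn_toLp, hv.coeFn_toLp,
    hw.coeFn_toLp] with x h1 h2 h3 h4
  rw [h1, Pi.sub_apply, h2, h3, h4]
  simp [mul_comm]

lemma exists_isOrthProj (hR : IsRieszGenerator g h) (hbu : UniformContinuous b)
    (hb : ∀ t (k : ℤ), b t k = g (t - h * k)) {u : ℝ → ℝ} (hu : MemLp u 2 volume) :
    ∃ v, IsOrthProj g h u v := by
  obtain ⟨T, hT, hcl⟩ := exists_synthesis_clm hR hbu hb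
  have hV : ∀ {w}, w ∈ shiftInvariantSpace g h → MemLp w 2 volume := fun hw =>
    memLp_of_mem_shiftInvariantSpace hR hbu hb hw
  set K : Submodule ℝ (Lp ℝ 2 (volume : Measure ℝ)) := LinearMap.range T.toLinearMap with hK
  have hKcl : IsClosed (K : Set (Lp ℝ 2 (volume : Measure ℝ))) := by
    have : (K : Set (Lp ℝ 2 (volume : Measure ℝ))) = range T := by
      ext x; simp [hK]
    rw [this]
    exact hcl
  have : CompleteSpace K := hKcl.completeSpace_coe
  obtain ⟨c, hc⟩ : K.starProjection (hu.toLp u) ∈ K := K.starProjection_apply_mem _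
  have hcV : (fun t => inner ℝ c (b t)) ∈ shiftInvariantSpace g h := ⟨c, isSynthesis_inner hb c⟩
  refine ⟨fun t => inner ℝ c (b t), hcV, fun w hw => ?_⟩
  obtain ⟨c', hc'⟩ := id hw
  rw [integral_sub_mul_eq_inner hu (hV hcV) (hV hw)]
  have h1 : (hV hcV).toLp _ = K.starProjection (hu.toLp u) := by
    rw [← hc]
    exact Lp.ext ((hV hcV).coeFn_toLp.trans (hT c).symm)
  have h2 : (hV hw).toLp w = T c' := by
    refine Lp.ext ((hV hw).coeFn_toLp.trans ?_)
    rw [hc'.eq_inner hb]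
    exact (hT c').symm
  rw [h1, h2]
  exact K.starProjection_inner_eq_zero _ _ ⟨c', rfl⟩

lemma isOrthProj_orthProj (hR : IsRieszGenerator g h) (hbu : UniformContinuous b)
    (hb : ∀ t (k : ℤ), b t k = g (t - h * k)) {u : ℝ → ℝ} (hu : MemLp u 2 volume) :
    IsOrthProj g h u (orthProj g h u) := by
  have hex := exists_isOrthProj hR hbu hb hu
  rw [orthProj, dif_pos hex]
  exact hex.choose_spec

lemma isOrthProj_self {f : ℝ → ℝ} (hf : f ∈ shiftInvariantSpace g h) : IsOrthProj g h f f :=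
  ⟨hf, fun w _ => by simp⟩

lemma IsOrthProj.congr_ae {u u' v : ℝ → ℝ} (huv : IsOrthProj g h u v) (hae : u =ᵐ[volume] u') :
    IsOrthProj g h u' v := by
  refine ⟨huv.1, fun w hw => ?_⟩
  rw [← huv.2 w hw]
  refine integral_congr_ae ?_
  filter_upwards [hae] with x hx
  rw [hx]

/-- Differences of orthogonal projections project the difference. The integrals in `IsOrthProj` are
additive because all functions are square integrable. -/
lemma IsOrthProj.sub (hR : IsRieszGenerator g h) (hbu : UniformContinuous b)
    (hb : ∀ t (k : ℤ), b t k = g (t - h * k)) {u u' v v' : ℝ → ℝ} (hu : MemLp u 2 volume)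
    (hu' : MemLp u' 2 volume) (huv : IsOrthProj g h u v) (huv' : IsOrthProj g h u' v') :
    IsOrthProj g h (u - u') (v - v') := by
  refine ⟨sub_mem_shiftInvariantSpace huv.1 huv'.1, fun w hw => ?_⟩
  have hV : ∀ {w}, w ∈ shiftInvariantSpace g h → MemLp w 2 volume := fun hw =>
    memLp_of_mem_shiftInvariantSpace hR hbu hb hw
  have h1 : Integrable fun x => (u x - v x) * w x := (hu.sub (hV huv.1)).integrable_mul (hV hw)
  have h2 : Integrable fun x => (u' x - v' x) * w x :=
    (hu'.sub (hV huv'.1)).integrable_mul (hV hw)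
  have h3 := integral_sub h1 h2
  rw [huv.2 w hw, huv'.2 w hw, sub_zero] at h3
  rw [← h3]
  refine integral_congr_ae (ae_of_all _ fun x => ?_)
  simp only [Pi.sub_apply]
  ring

lemma IsOrthProj.eLpNorm_le (hR : IsRieszGenerator g h) (hbu : UniformContinuous b)
    (hb : ∀ t (k : ℤ), b t k = g (t - h * k)) {u v : ℝ → ℝ} (hu : MemLp u 2 volume)
    (huv : IsOrthProj g h u v) : eLpNorm v 2 volume ≤ eLpNorm u 2 volume := by
  have hv : MemLp v 2 volume := memLp_of_mem_shiftInvariantSpace hR hbu hb huv.1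
  have h1 := huv.2 v huv.1
  rw [integral_sub_mul_eq_inner hu hv hv, inner_sub_left, real_inner_self_eq_norm_sq] at h1
  have h2 := real_inner_le_norm (hu.toLp u) (hv.toLp v)
  have h3 : ‖hv.toLp v‖ ≤ ‖hu.toLp u‖ := by
    by_contra! hlt
    nlinarith [norm_nonneg (hu.toLp u), norm_nonneg (hv.toLp v)]
  rw [Lp.norm_toLp, Lp.norm_toLp] at h3
  exact (ENNReal.toReal_le_toReal hv.2.ne hu.2.ne).1 h3

end Synthesis

/-! ### Convergence of the iterates -/

lemma HasL2Deriv.finSynthesis {g v : ℝ → ℝ} (hd : HasL2Deriv g v) (h : ℝ) (c : ℤ → ℝ)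
    (s : Finset ℤ) : HasL2Deriv (finSynthesis g h c s) (finSynthesis v h c s) :=
  HasL2Deriv.finset_sum (F := fun k t => c k * g (t - h * k))
    (V := fun k t => c k * v (t - h * k)) s
    fun k => (hd.comp_sub_right (h * k)).const_mul (c k)

/-- A density below `π / S` gives `γ < 1`. In the degenerate cases `S = 0` (where `π / S = ∞` is
truncated to the real number `0`) and `S = ∞` the value of `maxSpacing` is `0`, which no density
undercuts. -/
lemma contraction_of_samplingDensity_lt {h : ℝ} {g : ℝ → ℝ} {t : ℤ → ℝ}
    (hlt : samplingDensity t < ENNReal.ofReal (maxSpacing h g)) :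
    spectralRatio h g ≠ 0 ∧ spectralRatio h g ≠ ∞ ∧ samplingDensity t ≠ ∞ ∧
      contractionFactor h g t < 1 := by
  have hpos : 0 < maxSpacing h g := ENNReal.ofReal_pos.1 (bot_le.trans_lt hlt)
  have hpos' := ENNReal.toReal_pos_iff.1 hpos
  have hpi : ENNReal.ofReal Real.pi ≠ 0 := by simp [Real.pi_pos]
  have h0 : spectralRatio h g ≠ 0 := by
    intro h0
    rw [h0, ENNReal.div_zero hpi] at hpos'
    exact lt_irrefl _ hpos'.2
  have htop : spectralRatio h g ≠ ∞ := by
    intro htop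
    rw [htop, ENNReal.div_top] at hpos'
    exact lt_irrefl _ hpos'.1
  refine ⟨h0, htop, (hlt.trans ENNReal.ofReal_lt_top).ne, ?_⟩
  rw [maxSpacing, ENNReal.ofReal_toReal hpos'.2.ne,
    ENNReal.lt_div_iff_mul_lt (Or.inl h0) (Or.inl htop)] at hlt
  refine ENNReal.div_lt_of_lt_mul ?_
  rwa [one_mul, mul_comm]

section Reconstruction

variable {g : ℝ → ℝ} {h : ℝ} {b : ℝ → lp (fun _ : ℤ => ℝ) 2} {t : ℤ → ℝ}

/-- On finite sums of shifts, piecewise-constant interpolation is a perturbation of the identity of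
size `γ`: this is Wirtinger's inequality combined with Bernstein's. -/
lemma eLpNorm_finSynthesis_sub_piecewiseConstant_le (hg : MemLp g 2 volume)
    (hd : HasL2Deriv g (deriv g)) (hh : 0 < h) (ht : StrictMono t)
    (htop : Tendsto t atTop atTop) (hbot : Tendsto t atBot atBot)
    (hlt : samplingDensity t < ENNReal.ofReal (maxSpacing h g)) (c : ℤ → ℝ) (s : Finset ℤ) :
    eLpNorm (finSynthesis g h c s - piecewiseConstant t fun m => finSynthesis g h c s (t m))
        2 volume
      ≤ contractionFactor h g t * eLpNorm (finSynthesis g h c s) 2 volume := by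
  obtain ⟨h0, hS, hD, -⟩ := contraction_of_samplingDensity_lt hlt
  refine ((hd.finSynthesis h c s).eLpNorm_sub_piecewiseConstant_le ht htop hbot hD).trans ?_
  refine (mul_le_mul_right (eLpNorm_finSynthesis_deriv_le hg hd.memLp hh h0 hS c s) _).trans_eq ?_
  rw [contractionFactor, div_eq_mul_inv, div_eq_mul_inv]
  ring

/-- The same bound on all of `V(g)`, by approximation with finite sums and Fatou's lemma. -/
lemma eLpNorm_sub_piecewiseConstant_le (hR : IsRieszGenerator g h) (hbu : UniformContinuous b)
    (hb : ∀ t (k : ℤ), b t k = g (t - h * k)) (hg : MemLp g 2 volume)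
    (hd : HasL2Deriv g (deriv g)) (hh : 0 < h) (ht : StrictMono t)
    (htop : Tendsto t atTop atTop) (hbot : Tendsto t atBot atBot)
    (hlt : samplingDensity t < ENNReal.ofReal (maxSpacing h g)) {f : ℝ → ℝ}
    (hf : f ∈ shiftInvariantSpace g h) :
    eLpNorm (f - piecewiseConstant t fun m => f (t m)) 2 volume
      ≤ contractionFactor h g t * eLpNorm f 2 volume := by
  classical
  have hγ := (contraction_of_samplingDensity_lt hlt).2.2.2
  have hfL := memLp_of_mem_shiftInvariantSpace hR hbu hb hf
  obtain ⟨A, B, hA, hB, hAB⟩ := id hR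
  obtain ⟨c, hc⟩ := hf
  have hfc := hc.eq_inner hb
  -- the truncated coefficients and their signals
  set cn : ℕ → lp (fun _ : ℤ => ℝ) 2 := fun n =>
    ∑ k ∈ Finset.Icc (-(n : ℤ)) n, lp.single 2 k (c k) with hcn
  have hlim : Tendsto cn atTop (𝓝 c) :=
    (lp.hasSum_single (by norm_num) c : Tendsto _ _ _).comp Finset.tendsto_Icc_neg
  set F : ℕ → ℝ → ℝ := fun n => finSynthesis g h c (Finset.Icc (-(n : ℤ)) n) with hF
  have hFc : ∀ n, F n = fun x => inner ℝ (cn n) (b x) := by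
    intro n
    ext x
    simp only [hF, hcn, finSynthesis, sum_inner]
    refine Finset.sum_congr rfl fun k _ => ?_
    rw [lp.inner_single_left, hb]
    simp [mul_comm]
  have hpt : ∀ x, Tendsto (fun n => F n x) atTop (𝓝 (f x)) := by
    intro x
    simp_rw [hFc, hfc]
    exact hlim.inner tendsto_const_nhds
  have hFm : ∀ n, MemLp (F n) 2 volume := fun n => memLp_finSynthesis hg h c _
  have hptΓ : ∀ᵐ x, Tendsto (fun n => (F n - piecewiseConstant t fun m => F n (t m)) x) atTop
      (𝓝 ((f - piecewiseConstant t fun m => f (t m)) x)) := by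
    refine ae_of_forall_cell ht htop hbot fun m => ?_
    filter_upwards [piecewiseConstant_ae_eq ht (fun m => f (t m)) m,
      ae_all_iff.2 fun n => piecewiseConstant_ae_eq ht (fun m => F n (t m)) m] with x h1 h2
    simp only [Pi.sub_apply, h1, h2]
    exact (hpt x).sub (hpt (t m))
  have hFatou := Lp.eLpNorm_lim_le_liminf_eLpNorm (p := 2) (fun n =>
    (hFm n).aestronglyMeasurable.sub (aestronglyMeasurable_piecewiseConstant ht htop hbot _)) _ hptΓ
  have hbound : ∀ n, eLpNorm (F n - piecewiseConstant t fun m => F n (t m)) 2 volume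
      ≤ contractionFactor h g t *
        (eLpNorm f 2 volume + ENNReal.ofReal (B * ‖cn n - c‖)) := by
    intro n
    refine (eLpNorm_finSynthesis_sub_piecewiseConstant_le hg hd hh ht htop hbot hlt c _).trans
      (mul_le_mul_right ?_ _)
    have hsyn : IsSynthesis g h (cn n - c) (F n - f) := by
      have hs := isSynthesis_inner hb (cn n - c)
      have : F n - f = fun x => inner ℝ (cn n - c) (b x) := by
        rw [hFc, hfc]
        ext x
        simp [inner_sub_left]
      rwa [this]
    have h1 : F n = f + (F n - f) := by ring
    change eLpNorm (F n) 2 volume ≤ _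
    rw [h1]
    exact (eLpNorm_add_le hfL.aestronglyMeasurable ((hFm n).sub hfL).aestronglyMeasurable
      one_le_two).trans (add_le_add_right (hAB _ _ hsyn).2 _)
  have hrhs : Tendsto (fun n => contractionFactor h g t *
      (eLpNorm f 2 volume + ENNReal.ofReal (B * ‖cn n - c‖))) atTop
      (𝓝 (contractionFactor h g t * eLpNorm f 2 volume)) := by
    refine ENNReal.Tendsto.const_mul ?_ (Or.inr (hγ.trans ENNReal.one_lt_top).ne)
    have h1 : Tendsto (fun n => B * ‖cn n - c‖) atTop (𝓝 0) := by
      simpa using (tendsto_iff_norm_sub_tendsto_zero.1 hlim).const_mul B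
    simpa using (tendsto_const_nhds (x := eLpNorm f 2 volume)).add (ENNReal.tendsto_ofReal h1)
  exact hFatou.trans ((liminf_le_liminf (Eventually.of_forall hbound)).trans_eq hrhs.liminf_eq)

/-- The frame algorithm: the error `e_k = f - f_k` lies in `V(g)`, and `e_{k+1}` is the orthogonal
projection of `e_k - Γ e_k`. -/
lemma isReconstructedFrom_samples (hR : IsRieszGenerator g h) (hbu : UniformContinuous b)
    (hb : ∀ t (k : ℤ), b t k = g (t - h * k)) (hg : MemLp g 2 volume)
    (hd : HasL2Deriv g (deriv g)) (hh : 0 < h) (ht : StrictMono t)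
    (htop : Tendsto t atTop atTop) (hbot : Tendsto t atBot atBot)
    (hlt : samplingDensity t < ENNReal.ofReal (maxSpacing h g)) {f : ℝ → ℝ}
    (hf : f ∈ shiftInvariantSpace g h) :
    IsReconstructedFrom f g h t (fun m => f (t m)) := by
  have hγ := (contraction_of_samplingDensity_lt hlt).2.2.2
  set γ := contractionFactor h g t with hγdef
  have hV : ∀ {e}, e ∈ shiftInvariantSpace g h → MemLp e 2 volume := fun he =>
    memLp_of_mem_shiftInvariantSpace hR hbu hb he
  have hcontr : ∀ {e}, e ∈ shiftInvariantSpace g h →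
      eLpNorm (e - piecewiseConstant t fun m => e (t m)) 2 volume ≤ γ * eLpNorm e 2 volume :=
    fun he => eLpNorm_sub_piecewiseConstant_le hR hbu hb hg hd hh ht htop hbot hlt he
  have hdiff : ∀ {e}, e ∈ shiftInvariantSpace g h →
      MemLp (e - piecewiseConstant t fun m => e (t m)) 2 volume := fun he =>
    ⟨(hV he).aestronglyMeasurable.sub (aestronglyMeasurable_piecewiseConstant ht htop hbot _),
      (hcontr he).trans_lt (ENNReal.mul_lt_top (hγ.trans ENNReal.one_lt_top) (hV he).2)⟩
  have hΓ : ∀ {e}, e ∈ shiftInvariantSpace g h →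
      MemLp (piecewiseConstant t fun m => e (t m)) 2 volume := fun he => by
    simpa using (hV he).sub (hdiff he)
  have hP : ∀ {e}, e ∈ shiftInvariantSpace g h → IsOrthProj g h
      (piecewiseConstant t fun m => e (t m))
      (orthProj g h (piecewiseConstant t fun m => e (t m))) := fun he =>
    isOrthProj_orthProj hR hbu hb (hΓ he)
  -- one step of the iteration contracts by the factor `γ`
  have hstep : ∀ {e w}, e ∈ shiftInvariantSpace g h →
      IsOrthProj g h (piecewiseConstant t fun m => e (t m)) w →
      e - w ∈ shiftInvariantSpace g h ∧ eLpNorm (e - w) 2 volume ≤ γ * eLpNorm e 2 volume := by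
    intro e w he hw
    have h1 := (isOrthProj_self he).sub hR hbu hb (hV he) (hΓ he) hw
    exact ⟨h1.1, (h1.eLpNorm_le hR hbu hb (hdiff he)).trans (hcontr he)⟩
  have hmain : ∀ k : ℕ, f - reconIterate g h t (fun m => f (t m)) k ∈ shiftInvariantSpace g h ∧
      eLpNorm (f - reconIterate g h t (fun m => f (t m)) k) 2 volume
        ≤ γ ^ (k + 1) * eLpNorm f 2 volume := by
    intro k
    induction k with
    | zero => simpa [reconIterate] using hstep hf (hP hf)
    | succ k ih =>
      set r := reconIterate g h t (fun m => f (t m)) k with hr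
      have hrV : r ∈ shiftInvariantSpace g h := by
        simpa using sub_mem_shiftInvariantSpace hf ih.1
      have hw : IsOrthProj g h (piecewiseConstant t fun m => (f - r) (t m))
          (orthProj g h (piecewiseConstant t fun m => f (t m))
            - orthProj g h (piecewiseConstant t fun m => r (t m))) :=
        ((hP hf).sub hR hbu hb (hΓ hf) (hΓ hrV) (hP hrV)).congr_ae
          (piecewiseConstant_sub_ae ht htop hbot _ _)
      have heq : f - reconIterate g h t (fun m => f (t m)) (k + 1)
          = (f - r) - (orthProj g h (piecewiseConstant t fun m => f (t m))
            - orthProj g h (piecewiseConstant t fun m => r (t m))) := by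
        rw [reconIterate]
        ring
      rw [heq]
      refine ⟨(hstep ih.1 hw).1, (hstep ih.1 hw).2.trans ?_⟩
      rw [pow_succ' γ (k + 1), mul_assoc]
      exact mul_le_mul_right ih.2 _
  refine ⟨hV hf, hγ, fun k => (hmain k).2, ?_⟩
  refine tendsto_of_tendsto_of_tendsto_of_le_of_le tendsto_const_nhds ?_ (fun _ => zero_le)
    (fun k => (hmain k).2)
  have hpow := (ENNReal.tendsto_pow_atTop_nhds_zero_of_lt_one hγ).comp (tendsto_add_atTop_nat 1)
  simpa using ENNReal.Tendsto.mul_const hpow (Or.inr (hV hf).2.ne)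

end Reconstruction

end

theorem corollary3 (φ : ℝ → ℝ) (h : ℝ) (hh : 0 < h)
    (hφ : MemLp φ 2 volume)
    (hac : ∀ a b : ℝ, AbsolutelyContinuousOnInterval φ a b)
    (hDφ : MemLp (deriv φ) 2 volume)
    (hRiesz : IsRieszGenerator (scaledKernel φ h) h) :
    -- signals of the model class are perfectly reconstructed from their events
    (∀ (f : ℝ → ℝ) (C : ℝ) (t p : ℤ → ℝ),
      f ∈ shiftInvariantSpace (scaledKernel φ h) h →
      0 < criticalThreshold f (maxSpacing h (scaledKernel φ h)) →
      0 < C → IsEventStream f C t p →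
      C < criticalThreshold f (maxSpacing h (scaledKernel φ h)) →
        StrictMono t ∧ Tendsto t atTop atTop ∧ Tendsto t atBot atBot ∧
        samplingDensity t < ENNReal.ofReal (maxSpacing h (scaledKernel φ h)) ∧
        (∀ m : ℤ, f (t m) = eventSamples C (f (t 0)) p m) ∧
        IsReconstructedFrom f (scaledKernel φ h) h t (eventSamples C (f (t 0)) p)) ∧
    -- below the critical threshold, events are dense (whether or not the input has finite energy)
    (∀ (f : ℝ → ℝ) (C Δ : ℝ) (t p : ℤ → ℝ),
      UniformContinuous f → 0 < C → IsEventStream f C t p →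
      C < criticalThreshold f Δ →
        StrictMono t ∧ Tendsto t atTop atTop ∧ Tendsto t atBot atBot ∧
        samplingDensity t < ENNReal.ofReal Δ ∧
        (∀ m : ℤ, f (t m) = eventSamples C (f (t 0)) p m)) ∧
    -- instants of that density determine every signal of the model class
    (∀ t : ℤ → ℝ, StrictMono t → Tendsto t atTop atTop → Tendsto t atBot atBot →
      samplingDensity t < ENNReal.ofReal (maxSpacing h (scaledKernel φ h)) →
      ∀ f ∈ shiftInvariantSpace (scaledKernel φ h) h,
        IsReconstructedFrom f (scaledKernel φ h) h t (fun m => f (t m))) := by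

  obtain ⟨b, hbu, hb⟩ := exists_uniformContinuous_samples_scaledKernel
    (v := deriv φ) ⟨hDφ, fun a b => (hac a b).integral_deriv_eq_sub⟩ hφ hh
  have hrec : ∀ t : ℤ → ℝ, StrictMono t → Tendsto t atTop atTop → Tendsto t atBot atBot →
      samplingDensity t < ENNReal.ofReal (maxSpacing h (scaledKernel φ h)) →
      ∀ f ∈ shiftInvariantSpace (scaledKernel φ h) h,
        IsReconstructedFrom f (scaledKernel φ h) h t (fun m => f (t m)) :=
    fun t ht htop hbot hlt f hf => isReconstructedFrom_samples hRiesz hbu hb (hφ.comp_div hh)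
      (hasL2Deriv_scaledKernel hac hDφ hh) hh ht htop hbot hlt hf
  refine ⟨fun f C t p hf _ hC hs hCf => ?_, fun f C Δ t p hf hC hs hCf =>
    ⟨hs.strictMono, hs.tendsto_atTop hf.continuous hC, hs.tendsto_atBot hf.continuous hC,
      hs.samplingDensity_lt hf hC hCf, hs.apply_eq_eventSamples⟩, hrec⟩
  have hfu := uniformContinuous_of_mem_shiftInvariantSpace hbu hb hf
  have ht := hs.strictMono
  have htop := hs.tendsto_atTop hfu.continuous hC
  have hbot := hs.tendsto_atBot hfu.continuous hC
  have hlt := hs.samplingDensity_lt hfu hC hCf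
  refine ⟨ht, htop, hbot, hlt, hs.apply_eq_eventSamples, ?_⟩
  have hy : (fun m => f (t m)) = eventSamples C (f (t 0)) p := funext hs.apply_eq_eventSamples
  rw [← hy]
  exact hrec t ht htop hbot hlt f hf
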